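/- Let $\mathbb{H}$ be the quaternions, $\mathbb{B}\subset\mathbb{H}$ the open unit ball, $\mathrm{Sp}(1)=\{u\in\mathbb{H}: |u|=1\}$ and $\mathrm{Sp}(1,1)=\{A\in M_2(\mathbb{H}): A^*I_{1,1}A=I_{1,1}\}$ with $I_{1,1}=\mathrm{diag}(1,-1)$, a Lie group and an embedded submanifold of $M_2(\mathbb{H})\cong\mathbb{R}^{16}$. For functions on $\mathbb{B}$ given by convergent power series with right coefficients, $f(q)=\sum_n q^na_n$ and $g(q)=\sum_n q^nb_n$, put $(f*g)(q)=\sum_n q^n\sum_{k=0}^n a_kb_{n-k}$, $f^c(q)=\sum_n q^n\overline{a}_n$, $f^s=f*f^c$ and $f^{-*}=(f^s)^{-1}f^c$ (off the zeros of $f^s$). For $A=\begin{pmatrix}a&c\\ b&d\end{pmatrix}\in\mathrm{Sp}(1,1)$ let $\mathcal{F}_A:\mathbb{B}\to\mathbb{B}$, $\mathcal{F}_A(q)=(qc+d)^{-*}*(qa+b)$, be the slice regular Möbius transformation of $A$, and let $\mathcal{M}(\mathbb{B})=\{\mathcal{F}_A: A\in\mathrm{Sp}(1,1)\}$. The set $\mathcal{M}(\mathbb{B})\cong\mathrm{Sp}(1,1)/\mathrm{Sp}(1)I_2$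 admits a (Hausdorff, second countable) smooth manifold structure of dimension $7$ with the quotient topology for which the map $\mathrm{Sp}(1,1)\to\mathcal{M}(\mathbb{B})$, $A\mapsto\mathcal{F}_{A^{-1}}$, is a submersion, i.e. smooth and surjective with surjective differential at every point. For this manifold structure the evaluation map $$\mathcal{M}(\mathbb{B})\times\mathbb{B}\to\mathbb{B},\qquad(\mathcal{F},q)\mapsto\mathcal{F}(q),$$ is smooth, and the following hold. 1. (Transitivity) For every $p,q\in\mathbb{B}$ there is $\mathcal{F}\in\mathcal{M}(\mathbb{B})$ with $\mathcal{F}(p)=q$. 2. (Isotropy at $0$) $\mathcal{M}(\mathbb{B})_0:=\{\mathcal{F}\in\mathcal{M}(\mathbb{B}):\mathcal{F}(0)=0\}=\{R_u:u\in\mathrm{Sp}(1)\}$, where $R_u(q)=qu$ for $q\in\mathbb{B}$. 3. (Structure of the isotropy) $\mathcal{M}(\mathbb{B})_0$ is a compact (embedded, $3$-dimensional) submanifold of $\mathcal{M}(\mathbb{B})$, and with this manifold structure and the composition of maps it is a Lie group. The map $\rho:\mathrm{Sp}(1)\to\mathcal{M}(\mathbb{B})_0$, $u\mapsto R_{u^{-1}}$,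 is an isomorphism of Lie groups (a group isomorphism that is smooth with smooth inverse). -/

import Mathlib

open scoped Manifold ContDiff Quaternion Matrix

noncomputable section

namespace RegMobius

/-! ### The unit ball, the unit quaternions and the group `Sp(1,1)` -/

/-- The open unit ball `𝔹` of the quaternions, an open submanifold of `ℍ`. -/
abbrev Ball : TopologicalSpace.Opens ℍ := ⟨Metric.ball 0 1, Metric.isOpen_ball⟩

theorem norm_lt_one (q : Ball) : ‖(q : ℍ)‖ < 1 :=
  mem_ball_zero_iff.1 q.2

instance : Zero Ball := ⟨⟨0, Metric.mem_ball_self one_pos⟩⟩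

/-- `Sp(1)`, the unit sphere of `ℍ`, with Mathlib's group structure (quaternion multiplication)
and Mathlib's manifold structure of the sphere. -/
abbrev Sp1 : Type := Metric.sphere (0 : ℍ) 1

instance : Fact (Module.finrank ℝ ℍ = 3 + 1) := ⟨Quaternion.finrank_eq_four⟩

theorem norm_Sp1 (u : Sp1) : ‖(u : ℍ)‖ = 1 := by simp

/-- The matrix `I_{1,1} = diag(1, -1)`. -/
def J : Matrix (Fin 2) (Fin 2) ℍ := !![1, 0; 0, -1]

theorem J_mul_J : J * J = 1 := by
  refine Matrix.ext fun i j => ?_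
  fin_cases i <;> fin_cases j <;> simp [J, Matrix.mul_apply, Fin.sum_univ_two]

theorem J_conjTranspose : Jᴴ = J := by
  refine Matrix.ext fun i j => ?_
  fin_cases i <;> fin_cases j <;> simp [J, Matrix.conjTranspose_apply]

/-- `Sp(1,1) = {A ∈ M₂(ℍ) : A* I_{1,1} A = I_{1,1}}`, with the topology of a subspace of the
matrices. -/
def Sp11 : Submonoid (Matrix (Fin 2) (Fin 2) ℍ) where
  carrier := {A | Aᴴ * J * A = J}
  one_mem' := by simp
  mul_mem' := by
    intro A B hA hB
    simp only [Set.mem_ofPred_eq] at *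
    calc (A * B)ᴴ * J * (A * B) = Bᴴ * (Aᴴ * J * A) * B := by
          simp only [Matrix.conjTranspose_mul, Matrix.mul_assoc]
      _ = J := by rw [hA, hB]

namespace Sp11

theorem mem_iff {A : Matrix (Fin 2) (Fin 2) ℍ} : A ∈ Sp11 ↔ Aᴴ * J * A = J := Iff.rfl

theorem inv_mul_aux (A : Sp11) : (J * (A : Matrix (Fin 2) (Fin 2) ℍ)ᴴ * J) * A = 1 := by
  have h : (A : Matrix (Fin 2) (Fin 2) ℍ)ᴴ * J * A = J := A.2
  rw [Matrix.mul_assoc J, Matrix.mul_assoc J, h, J_mul_J]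

theorem mul_inv_aux (A : Sp11) :
    (A : Matrix (Fin 2) (Fin 2) ℍ) * (J * (A : Matrix (Fin 2) (Fin 2) ℍ)ᴴ * J) = 1 :=
  mul_eq_one_symm (inv_mul_aux A)

theorem mul_J_mul (A : Sp11) :
    (A : Matrix (Fin 2) (Fin 2) ℍ) * J * (A : Matrix (Fin 2) (Fin 2) ℍ)ᴴ = J := by
  have h := congrArg (· * J) (mul_inv_aux A)
  simpa [Matrix.mul_assoc, J_mul_J] using h

theorem inv_mem (A : Sp11) : J * (A : Matrix (Fin 2) (Fin 2) ℍ)ᴴ * J ∈ Sp11 := by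
  rw [mem_iff]
  simp only [Matrix.conjTranspose_mul, Matrix.conjTranspose_conjTranspose, J_conjTranspose]
  calc J * ((A : Matrix (Fin 2) (Fin 2) ℍ) * J) * J * (J * (A : Matrix (Fin 2) (Fin 2) ℍ)ᴴ * J)
      = J * ((A : Matrix (Fin 2) (Fin 2) ℍ) * J * (J * J) * (A : Matrix (Fin 2) (Fin 2) ℍ)ᴴ) * J := by
        simp only [Matrix.mul_assoc]
    _ = J := by rw [J_mul_J, Matrix.mul_one, mul_J_mul, J_mul_J, Matrix.one_mul]

/-- `Sp(1,1)` is a group under matrix multiplication, with `A⁻¹ = I_{1,1} A* I_{1,1}`. -/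
instance : Group Sp11 where
  inv A := ⟨J * (A : Matrix (Fin 2) (Fin 2) ℍ)ᴴ * J, inv_mem A⟩
  inv_mul_cancel A := Subtype.ext (inv_mul_aux A)

theorem coe_inv (A : Sp11) :
    ((A⁻¹ : Sp11) : Matrix (Fin 2) (Fin 2) ℍ) = J * (A : Matrix (Fin 2) (Fin 2) ℍ)ᴴ * J := rfl

theorem mem_iff_entries {A : Matrix (Fin 2) (Fin 2) ℍ} : A ∈ Sp11 ↔
    star (A 0 0) * A 0 0 - star (A 1 0) * A 1 0 = 1 ∧
    star (A 0 0) * A 0 1 - star (A 1 0) * A 1 1 = 0 ∧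
    star (A 0 1) * A 0 0 - star (A 1 1) * A 1 0 = 0 ∧
    star (A 0 1) * A 0 1 - star (A 1 1) * A 1 1 = -1 := by
  rw [mem_iff, ← Matrix.ext_iff]
  simp [Fin.forall_fin_two, J, Matrix.mul_apply, Fin.sum_univ_two, Matrix.conjTranspose_apply,
    sub_eq_add_neg, and_assoc]

theorem row_entries (A : Sp11) :
    A.1 0 0 * star (A.1 0 0) - A.1 0 1 * star (A.1 0 1) = 1 ∧
    A.1 0 0 * star (A.1 1 0) - A.1 0 1 * star (A.1 1 1) = 0 ∧
    A.1 1 0 * star (A.1 0 0) - A.1 1 1 * star (A.1 0 1) = 0 ∧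
    A.1 1 0 * star (A.1 1 0) - A.1 1 1 * star (A.1 1 1) = -1 := by
  have h := mul_J_mul A
  rw [← Matrix.ext_iff] at h
  simpa [Fin.forall_fin_two, J, Matrix.mul_apply, Fin.sum_univ_two, Matrix.conjTranspose_apply,
    sub_eq_add_neg, and_assoc] using h

theorem star_mul_self_eq (x : ℍ) : star x * x = ((‖x‖ ^ 2 : ℝ) : ℍ) := by
  rw [Quaternion.star_mul_self, Quaternion.normSq_eq_norm_mul_self, sq]

theorem self_mul_star_eq (x : ℍ) : x * star x = ((‖x‖ ^ 2 : ℝ) : ℍ) := by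
  rw [Quaternion.self_mul_star, Quaternion.normSq_eq_norm_mul_self, sq]

theorem norm_sq_col (A : Sp11) : ‖A.1 0 0‖ ^ 2 - ‖A.1 1 0‖ ^ 2 = 1 := by
  have h := (mem_iff_entries.1 A.2).1
  rw [star_mul_self_eq, star_mul_self_eq] at h
  refine Quaternion.coe_injective ?_
  push_cast at h ⊢
  exact h

theorem norm_sq_row₀ (A : Sp11) : ‖A.1 0 0‖ ^ 2 - ‖A.1 0 1‖ ^ 2 = 1 := by
  have h := (row_entries A).1
  rw [self_mul_star_eq, self_mul_star_eq] at h
  refine Quaternion.coe_injective ?_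
  push_cast at h ⊢
  exact h

theorem norm_sq_row₁ (A : Sp11) : ‖A.1 1 0‖ ^ 2 - ‖A.1 1 1‖ ^ 2 = -1 := by
  have h := (row_entries A).2.2.2
  rw [self_mul_star_eq, self_mul_star_eq] at h
  refine Quaternion.coe_injective ?_
  push_cast at h ⊢
  exact h

theorem norm_01_lt (A : Sp11) : ‖A.1 0 1‖ < ‖A.1 1 1‖ := by
  have h1 := norm_sq_col A
  have h2 := norm_sq_row₀ A
  have h3 := norm_sq_row₁ A
  refine lt_of_pow_lt_pow_left₀ 2 (norm_nonneg _) ?_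
  linarith

end Sp11

/-! ### The manifold structure of `Sp(1,1)`

`Sp(1,1)` is a closed embedded submanifold of the space of matrices.  It has a global
parametrization by `ℍ × S³ × S³`, namely
`(b, u, v) ↦ (s u, u b̄ v; b, s v)` with `s = √(1 + |b|²)`, whose inverse is
`A ↦ (b, a/|a|, d/|d|)`.  The charts of `Sp(1,1)` are obtained from it; `Sp11.contMDiff_iff` checks
that this is the structure of an embedded submanifold of the matrices. -/

namespace Sp11

theorem norm_row_eq (A : Sp11) :
    ‖A.1 0 0‖ = √(1 + ‖A.1 1 0‖ ^ 2) ∧ ‖A.1 1 1‖ = √(1 + ‖A.1 1 0‖ ^ 2) := by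
  have h1 := norm_sq_col A
  have h3 := norm_sq_row₁ A
  constructor <;> (symm; rw [Real.sqrt_eq_iff_eq_sq (by positivity) (norm_nonneg _)]; linarith)

theorem norm_pos (A : Sp11) : 0 < ‖A.1 0 0‖ ∧ 0 < ‖A.1 1 1‖ := by
  rw [(norm_row_eq A).1, (norm_row_eq A).2]
  exact ⟨Real.sqrt_pos.2 (by positivity), Real.sqrt_pos.2 (by positivity)⟩

/-- The matrix with coordinates `(b, u, v)`. -/
def paramMatrix (x : ℍ × ℍ × ℍ) : Matrix (Fin 2) (Fin 2) ℍ :=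
  !![√(1 + ‖x.1‖ ^ 2) • x.2.1, x.2.1 * star x.1 * x.2.2; x.1, √(1 + ‖x.1‖ ^ 2) • x.2.2]

theorem paramMatrix_mem (b : ℍ) (u v : Sp1) : paramMatrix (b, u, v) ∈ Sp11 := by
  have hs : √(1 + ‖b‖ ^ 2) ^ 2 = 1 + ‖b‖ ^ 2 := Real.sq_sqrt (by positivity)
  have hu : star (u : ℍ) * u = 1 := by rw [star_mul_self_eq]; simp
  have hv : star (v : ℍ) * v = 1 := by rw [star_mul_self_eq]; simp
  have h1 : star (√(1 + ‖b‖ ^ 2) • (u : ℍ)) * (u * star b * v)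
      = star b * √(1 + ‖b‖ ^ 2) • (v : ℍ) := by
    rw [Quaternion.star_smul, smul_mul_assoc, mul_smul_comm, mul_assoc, ← mul_assoc (star (u : ℍ)),
      hu, one_mul]
  rw [mem_iff_entries]
  refine ⟨?_, ?_, ?_, ?_⟩
  · simp only [paramMatrix, Matrix.of_apply, Matrix.cons_val', Matrix.cons_val_zero,
      Matrix.cons_val_one, Matrix.cons_val_fin_one]
    rw [star_mul_self_eq, star_mul_self_eq, norm_smul, mul_pow, Real.norm_eq_abs, sq_abs, hs]
    simp
  · simp only [paramMatrix, Matrix.of_apply, Matrix.cons_val', Matrix.cons_val_zero,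
      Matrix.cons_val_one, Matrix.cons_val_fin_one]
    rw [h1, sub_self]
  · simp only [paramMatrix, Matrix.of_apply, Matrix.cons_val', Matrix.cons_val_zero,
      Matrix.cons_val_one, Matrix.cons_val_fin_one]
    rw [sub_eq_zero]
    simpa using congrArg star h1
  · simp only [paramMatrix, Matrix.of_apply, Matrix.cons_val', Matrix.cons_val_zero,
      Matrix.cons_val_one, Matrix.cons_val_fin_one]
    rw [star_mul_self_eq, star_mul_self_eq, norm_smul, mul_pow, Real.norm_eq_abs, sq_abs, hs]
    simp

theorem normalize_mem {x : ℍ} (hx : 0 < ‖x‖) : ‖x‖⁻¹ • x ∈ Metric.sphere (0 : ℍ) 1 := by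
  rw [mem_sphere_zero_iff_norm, norm_smul, norm_inv, norm_norm, inv_mul_cancel₀ hx.ne']

theorem entry_01 (A : Sp11) : A.1 0 1 =
    (‖A.1 0 0‖⁻¹ • A.1 0 0) * star (A.1 1 0) * (‖A.1 1 1‖⁻¹ • A.1 1 1) := by
  have h := (mem_iff_entries.1 A.2).2.1
  rw [sub_eq_zero] at h
  have h2 := congrArg (A.1 0 0 * ·) h
  simp only [← mul_assoc] at h2
  rw [self_mul_star_eq, Quaternion.coe_mul_eq_smul] at h2
  have hn : ‖A.1 1 1‖ = ‖A.1 0 0‖ := by rw [(norm_row_eq A).1, (norm_row_eq A).2]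
  have hp := (norm_pos A).1.ne'
  rw [smul_mul_assoc, smul_mul_assoc, mul_smul_comm, ← h2, hn, smul_smul, smul_smul]
  have : ‖A.1 0 0‖⁻¹ * ‖A.1 0 0‖⁻¹ * ‖A.1 0 0‖ ^ 2 = 1 := by field_simp
  rw [this, one_smul]

/-- The global parametrization of `Sp(1,1)`, as a homeomorphism. -/
def homeo : Sp11 ≃ₜ ℍ × Sp1 × Sp1 where
  toFun A := (A.1 1 0, ⟨‖A.1 0 0‖⁻¹ • A.1 0 0, normalize_mem (norm_pos A).1⟩,
    ⟨‖A.1 1 1‖⁻¹ • A.1 1 1, normalize_mem (norm_pos A).2⟩)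
  invFun x := ⟨paramMatrix (x.1, x.2.1, x.2.2), paramMatrix_mem _ _ _⟩
  left_inv A := by
    refine Subtype.ext (Matrix.ext fun i j => ?_)
    have h0 := (norm_row_eq A).1
    have h1 := (norm_row_eq A).2
    fin_cases i <;> fin_cases j
    · simp only [paramMatrix, Fin.zero_eta, Matrix.of_apply, Matrix.cons_val', Matrix.cons_val_zero,
        Matrix.cons_val_fin_one]
      rw [← h0, smul_smul, mul_inv_cancel₀ (norm_pos A).1.ne', one_smul]
    · exact (entry_01 A).symm
    · rfl
    · simp only [paramMatrix, Fin.mk_one, Matrix.of_apply, Matrix.cons_val', Matrix.cons_val_one,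
        Matrix.cons_val_fin_one]
      rw [← h1, smul_smul, mul_inv_cancel₀ (norm_pos A).2.ne', one_smul]
  right_inv x := by
    obtain ⟨b, u, v⟩ := x
    have hs : 0 < √(1 + ‖b‖ ^ 2) := Real.sqrt_pos.2 (by positivity)
    have key : ∀ w : Sp1, ‖√(1 + ‖b‖ ^ 2) • (w : ℍ)‖⁻¹ • √(1 + ‖b‖ ^ 2) • (w : ℍ) = w := by
      intro w
      rw [norm_smul, norm_Sp1, mul_one, Real.norm_of_nonneg hs.le, smul_smul,
        inv_mul_cancel₀ hs.ne', one_smul]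
    refine Prod.ext rfl (Prod.ext (Subtype.ext (key u)) (Subtype.ext (key v)))
  continuous_toFun := by
    have he : ∀ i j, Continuous fun A : Sp11 => A.1 i j := fun i j =>
      (continuous_apply_apply i j).comp continuous_subtype_val
    refine (he 1 0).prodMk (Continuous.prodMk ?_ ?_)
    · exact Continuous.subtype_mk
        (((he 0 0).norm.inv₀ fun A => (norm_pos A).1.ne').smul (he 0 0)) _
    · exact Continuous.subtype_mk
        (((he 1 1).norm.inv₀ fun A => (norm_pos A).2.ne').smul (he 1 1)) _
  continuous_invFun := by
    refine Continuous.subtype_mk (continuous_matrix fun i j => ?_) _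
    fin_cases i <;> fin_cases j <;> simp [paramMatrix] <;> fun_prop

/-- The model space `ℝ⁴ × ℝ³ × ℝ³` of `Sp(1,1)`. -/
abbrev Model : Type :=
  ModelProd ℍ (ModelProd (EuclideanSpace ℝ (Fin 3)) (EuclideanSpace ℝ (Fin 3)))

/-- The model with corners of `Sp(1,1)`. -/
abbrev model : ModelWithCorners ℝ (ℍ × EuclideanSpace ℝ (Fin 3) × EuclideanSpace ℝ (Fin 3)) Model :=
  𝓘(ℝ, ℍ).prod ((𝓡 3).prod (𝓡 3))

instance : ChartedSpace Model Sp11 where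
  atlas := {e | ∃ c ∈ atlas Model (ℍ × Sp1 × Sp1), e = homeo.toOpenPartialHomeomorph ≫ₕ c}
  chartAt A := homeo.toOpenPartialHomeomorph ≫ₕ chartAt Model (homeo A)
  mem_chart_source A := by simp
  chart_mem_atlas A := ⟨_, chart_mem_atlas _ _, rfl⟩

theorem chartAt_eq (A : Sp11) :
    chartAt Model A = homeo.toOpenPartialHomeomorph ≫ₕ chartAt Model (homeo A) := rfl

instance : IsManifold model ∞ Sp11 where
  compatible := by
    rintro _ _ ⟨c, hc, rfl⟩ ⟨c', hc', rfl⟩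
    have : (homeo.toOpenPartialHomeomorph ≫ₕ c).symm ≫ₕ homeo.toOpenPartialHomeomorph ≫ₕ c'
        = c.symm ≫ₕ c' := by
      rw [OpenPartialHomeomorph.trans_symm_eq_symm_trans_symm, OpenPartialHomeomorph.trans_assoc,
        ← OpenPartialHomeomorph.trans_assoc _ homeo.toOpenPartialHomeomorph,
        ← Homeomorph.symm_toOpenPartialHomeomorph, ← Homeomorph.trans_toOpenPartialHomeomorph,
        Homeomorph.symm_trans_self, Homeomorph.refl_toOpenPartialHomeomorph,
        OpenPartialHomeomorph.refl_trans]
    rw [this]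
    have : IsManifold model ∞ (ℍ × Sp1 × Sp1) := inferInstance
    exact this.compatible hc hc'

section

variable {E H N : Type*} [NormedAddCommGroup E] [NormedSpace ℝ E] [TopologicalSpace H]
  {I : ModelWithCorners ℝ E H} [TopologicalSpace N] [ChartedSpace H N]

theorem contMDiff_iff_homeo {f : N → Sp11} :
    ContMDiff I model ∞ f ↔ ContMDiff I model ∞ (fun x => homeo (f x)) := by
  refine forall_congr' fun x => ?_
  rw [contMDiffAt_iff_target, contMDiffAt_iff_target (f := fun x => homeo (f x))]
  refine and_congr ?_ Iff.rfl
  exact (homeo.comp_continuousAt_iff f x).symm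

theorem contMDiff_homeo : ContMDiff model model ∞ homeo :=
  contMDiff_iff_homeo.1 contMDiff_id

theorem contMDiff_sqrt_one_add : ContDiff ℝ ∞ fun b : ℍ => √(1 + ‖b‖ ^ 2) :=
  (contDiff_const.add (contDiff_norm_sq ℝ)).sqrt fun b => by positivity

/-- The matrix entries are smooth functions on `Sp(1,1)`. -/
theorem contMDiff_entry (i j : Fin 2) :
    ContMDiff model 𝓘(ℝ, ℍ) ∞ (fun A : Sp11 => A.1 i j) := by
  have hb : ContMDiff model 𝓘(ℝ, ℍ) ∞ (fun x : ℍ × Sp1 × Sp1 => x.1) := contMDiff_fst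
  have hu : ContMDiff model 𝓘(ℝ, ℍ) ∞ (fun x : ℍ × Sp1 × Sp1 => (x.2.1 : ℍ)) :=
    contMDiff_coe_sphere.comp (contMDiff_fst.comp contMDiff_snd)
  have hv : ContMDiff model 𝓘(ℝ, ℍ) ∞ (fun x : ℍ × Sp1 × Sp1 => (x.2.2 : ℍ)) :=
    contMDiff_coe_sphere.comp (contMDiff_snd.comp contMDiff_snd)
  have hc : ContDiff ℝ ∞ fun y : ℍ × ℍ × ℍ => paramMatrix y i j := by
    have h1 : ContDiff ℝ ∞ fun y : ℍ × ℍ × ℍ => √(1 + ‖y.1‖ ^ 2) :=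
      contMDiff_sqrt_one_add.comp contDiff_fst
    have h2 : ContDiff ℝ ∞ fun y : ℍ × ℍ × ℍ => star y.1 :=
      (LinearMap.toContinuousLinearMap (⟨⟨star, star_add⟩, Quaternion.star_smul⟩ :
        ℍ →ₗ[ℝ] ℍ)).contDiff.comp contDiff_fst
    have h3 : ContDiff ℝ ∞ fun y : ℍ × ℍ × ℍ => y.2.1 := contDiff_fst.comp contDiff_snd
    have h4 : ContDiff ℝ ∞ fun y : ℍ × ℍ × ℍ => y.2.2 := contDiff_snd.comp contDiff_snd
    fin_cases i <;> fin_cases j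
    · exact h1.smul h3
    · exact (h3.mul h2).mul h4
    · exact contDiff_fst
    · exact h1.smul h4
  have := hc.contMDiff.comp ((hb.prodMk_space (hu.prodMk_space hv)).comp contMDiff_homeo)
  refine this.congr fun A => ?_
  exact congrArg (fun B : Sp11 => B.1 i j) (homeo.symm_apply_apply A).symm

/-- `Sp(1,1)` is an embedded submanifold of the space of matrices: a map into it is smooth if and
only if it is smooth as a map into the matrices, that is, if its entries are smooth. -/
theorem contMDiff_iff [IsManifold I ∞ N] {f : N → Sp11} :
    ContMDiff I model ∞ f ↔ ∀ i j, ContMDiff I 𝓘(ℝ, ℍ) ∞ (fun x => (f x).1 i j) := by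
  refine ⟨fun h i j => (contMDiff_entry i j).comp h, fun h => ?_⟩
  rw [contMDiff_iff_homeo]
  have hpos : ∀ (g : N → ℍ), (∀ x, 0 < ‖g x‖) → ContMDiff I 𝓘(ℝ, ℍ) ∞ g →
      ContMDiff I 𝓘(ℝ, ℍ) ∞ (fun x => ‖g x‖⁻¹ • g x) := by
    intro g hg hgs
    have : ContDiffOn ℝ ∞ (fun y : ℍ => ‖y‖⁻¹ • y) {0}ᶜ := by
      intro y hy
      exact (((contDiffAt_norm ℝ hy).inv (norm_ne_zero_iff.2 hy)).smul
        contDiffAt_id).contDiffWithinAt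
    exact this.contMDiffOn.comp_contMDiff hgs fun x => norm_pos_iff.1 (hg x)
  exact (h 1 0).prodMk (((hpos _ (fun x => (norm_pos (f x)).1) (h 0 0)).codRestrict_sphere
    fun x => normalize_mem (norm_pos (f x)).1).prodMk
    ((hpos _ (fun x => (norm_pos (f x)).2) (h 1 1)).codRestrict_sphere
    fun x => normalize_mem (norm_pos (f x)).2))

end

end Sp11

/-! ### Power series of a quaternionic variable and the `*`-product

A power series `∑ qⁿ aₙ` with right coefficients is a formal power series over `ℍ`; the variable
commutes with the coefficients, so the multiplication of formal power series is
`cₙ = ∑ₖ aₖ bₙ₋ₖ`, the `*`-product. -/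

/-- `f(q) = ∑ qⁿ aₙ` on `𝔹`, where `aₙ` are the coefficients of `p`. -/
def IsSliceSeries (f : Ball → ℍ) (p : PowerSeries ℍ) : Prop :=
  ∀ q : Ball, HasSum (fun n : ℕ => (q : ℍ) ^ n * PowerSeries.coeff n p) (f q)

open Classical in
/-- The power series expansion of a slice regular function on `𝔹` (it is unique, see
`IsSliceSeries.sliceSeries_eq`). -/
def sliceSeries (f : Ball → ℍ) : PowerSeries ℍ :=
  if h : ∃ p, IsSliceSeries f p then h.choose else 0

/-- The regular product `f * g`: `(f * g)(q) = ∑ qⁿ cₙ` with `cₙ = ∑_{k ≤ n} aₖ bₙ₋ₖ`. -/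
def starMul (f g : Ball → ℍ) (q : Ball) : ℍ :=
  ∑' n : ℕ, (q : ℍ) ^ n *
    ∑ k ∈ Finset.range (n + 1),
      PowerSeries.coeff k (sliceSeries f) * PowerSeries.coeff (n - k) (sliceSeries g)

/-- The regular conjugate `fᶜ(q) = ∑ qⁿ āₙ`. -/
def regConj (f : Ball → ℍ) (q : Ball) : ℍ :=
  ∑' n : ℕ, (q : ℍ) ^ n * star (PowerSeries.coeff n (sliceSeries f))

/-- The symmetrization `fˢ = f * fᶜ`. -/
def symmetrization (f : Ball → ℍ) : Ball → ℍ := starMul f (regConj f)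

/-- The regular reciprocal `f⁻* = (1 / fˢ) fᶜ` (off the zeros of `fˢ`). -/
def starInv (f : Ball → ℍ) (q : Ball) : ℍ := (symmetrization f q)⁻¹ * regConj f q

/-- The function `l_{(a,b)}(q) = q a + b`. -/
def lin (a b : ℍ) (q : Ball) : ℍ := q * a + b

theorem IsSliceSeries.unique {f : Ball → ℍ} {p p' : PowerSeries ℍ} (h : IsSliceSeries f p)
    (h' : IsSliceSeries f p') : p = p' := by
  let s (p : PowerSeries ℍ) : FormalMultilinearSeries ℝ ℝ ℍ := fun n =>
    ContinuousMultilinearMap.mkPiRing ℝ (Fin n) (PowerSeries.coeff n p)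
  let F : ℝ → ℍ := fun x => if hx : ‖(x : ℍ)‖ < 1 then f ⟨x, mem_ball_zero_iff.2 hx⟩ else 0
  have key : ∀ p, IsSliceSeries f p → HasFPowerSeriesAt F (s p) 0 := by
    intro p hp
    rw [hasFPowerSeriesAt_iff]
    filter_upwards [Metric.ball_mem_nhds (0 : ℝ) one_pos] with x hx
    have hx' : ‖(x : ℍ)‖ < 1 := by
      rw [Quaternion.norm_coe]; exact mem_ball_zero_iff.1 hx
    have := hp ⟨x, mem_ball_zero_iff.2 hx'⟩
    have hF : F (0 + x) = f ⟨x, mem_ball_zero_iff.2 hx'⟩ := by rw [zero_add]; exact dif_pos hx'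
    have he : (fun n => x ^ n • (s p).coeff n) =
        fun n => (x : ℍ) ^ n * PowerSeries.coeff n p := by
      funext n
      rw [← Quaternion.coe_pow, Quaternion.coe_mul_eq_smul]
      simp [s, FormalMultilinearSeries.coeff]
    rw [hF, he]
    exact this
  have := (key p h).eq_formalMultilinearSeries (key p' h')
  ext1 n
  have h2 := congrArg (fun t : FormalMultilinearSeries ℝ ℝ ℍ => t n (fun _ => 1)) this
  simpa [s] using h2

theorem IsSliceSeries.sliceSeries_eq {f : Ball → ℍ} {p : PowerSeries ℍ} (h : IsSliceSeries f p) :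
    sliceSeries f = p := by
  have hex : ∃ p, IsSliceSeries f p := ⟨p, h⟩
  rw [sliceSeries, dif_pos hex]
  exact hex.choose_spec.unique h

theorem coeff_zero_lin (a b : ℍ) :
    PowerSeries.coeff 0 (PowerSeries.C b + PowerSeries.X * PowerSeries.C a) = b := by
  rw [map_add, PowerSeries.coeff_zero_X_mul, PowerSeries.coeff_C, if_pos rfl, add_zero]

theorem coeff_one_lin (a b : ℍ) :
    PowerSeries.coeff 1 (PowerSeries.C b + PowerSeries.X * PowerSeries.C a) = a := by
  rw [map_add, PowerSeries.coeff_succ_X_mul, PowerSeries.coeff_C, PowerSeries.coeff_C,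
    if_neg one_ne_zero, if_pos rfl, zero_add]

theorem coeff_add_two_lin (a b : ℍ) (n : ℕ) :
    PowerSeries.coeff (n + 2) (PowerSeries.C b + PowerSeries.X * PowerSeries.C a) = 0 := by
  rw [map_add, PowerSeries.coeff_succ_X_mul, PowerSeries.coeff_C, PowerSeries.coeff_C,
    if_neg (by omega), if_neg (by omega), zero_add]

theorem isSliceSeries_lin (a b : ℍ) :
    IsSliceSeries (lin a b) (PowerSeries.C b + PowerSeries.X * PowerSeries.C a) := by
  intro q
  have := hasSum_sum_of_ne_finset_zero (L := SummationFilter.unconditional ℕ) (s := Finset.range 2)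
    (f := fun n => (q : ℍ) ^ n * PowerSeries.coeff n
      (PowerSeries.C b + PowerSeries.X * PowerSeries.C a)) (by
      intro n hn
      obtain ⟨m, rfl⟩ : ∃ m, n = m + 2 := ⟨n - 2, by simp at hn; omega⟩
      rw [coeff_add_two_lin, mul_zero])
  rw [Finset.sum_range_succ, Finset.sum_range_one, coeff_zero_lin, coeff_one_lin, pow_zero, pow_one,
    one_mul] at this
  have e : lin a b q = b + q * a := add_comm _ _
  rw [e]
  exact this

theorem starMul_eq {f g F : Ball → ℍ} {p r : PowerSeries ℍ} (hf : IsSliceSeries f p)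
    (hg : IsSliceSeries g r) (hF : IsSliceSeries F (p * r)) : starMul f g = F := by
  funext q
  rw [starMul, hf.sliceSeries_eq, hg.sliceSeries_eq, ← (hF q : HasSum _ _).tsum_eq]
  refine tsum_congr fun n => ?_
  rw [PowerSeries.coeff_mul, Finset.Nat.sum_antidiagonal_eq_sum_range_succ_mk]

theorem regConj_lin (a b : ℍ) : regConj (lin a b) = lin (star a) (star b) := by
  funext q
  rw [regConj, (isSliceSeries_lin a b).sliceSeries_eq, ← (isSliceSeries_lin _ _ q : HasSum _ _).tsum_eq]
  refine tsum_congr fun n => ?_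
  congr 1
  rcases n with _ | _ | n
  · rw [coeff_zero_lin, coeff_zero_lin]
  · rw [coeff_one_lin, coeff_one_lin]
  · rw [coeff_add_two_lin, coeff_add_two_lin, star_zero]

/-- `∑ qⁿ (aₙ b + aₙ₋₁ a) = f(q) b + q f(q) a`. -/
theorem IsSliceSeries.mul_lin {f : Ball → ℍ} {p : PowerSeries ℍ} (h : IsSliceSeries f p)
    (a b : ℍ) : IsSliceSeries (fun q => f q * b + q * f q * a)
      (p * (PowerSeries.C b + PowerSeries.X * PowerSeries.C a)) := by
  intro q
  have h1 := (h q).mul_right b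
  have h2 : HasSum (fun n : ℕ => (q : ℍ) ^ n * PowerSeries.coeff n
      (PowerSeries.X * (p * PowerSeries.C a))) (q * f q * a) := by
    rw [← hasSum_nat_add_iff' 1]
    simpa [pow_succ', mul_assoc, PowerSeries.coeff_succ_X_mul] using
      ((h q).mul_left (q : ℍ)).mul_right a
  have h3 : (fun n : ℕ => (q : ℍ) ^ n * PowerSeries.coeff n
      (p * (PowerSeries.C b + PowerSeries.X * PowerSeries.C a))) = fun n : ℕ =>
      (q : ℍ) ^ n * PowerSeries.coeff n p * b + (q : ℍ) ^ n * PowerSeries.coeff n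
      (PowerSeries.X * (p * PowerSeries.C a)) := by
    funext n
    rw [mul_add p, ← mul_assoc p, (PowerSeries.commute_X p).eq, mul_assoc PowerSeries.X, map_add,
      PowerSeries.coeff_mul_C, mul_add, mul_assoc]
  rw [h3]
  exact h1.add h2

/-- `l_{(c,d)}ˢ(q) = |d|² + 2 Re(c d̄) q + |c|² q²`. -/
theorem symmetrization_lin (c d : ℍ) (q : Ball) :
    symmetrization (lin c d) q = d * star d + q * (c * star d + d * star c) + q ^ 2 * (c * star c) := by
  rw [symmetrization, regConj_lin, starMul_eq (isSliceSeries_lin c d) (isSliceSeries_lin _ _)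
    ((isSliceSeries_lin c d).mul_lin _ _)]
  have h1 : (q : ℍ) * d * star c = q * (d * star c) := mul_assoc _ _ _
  simp only [lin]
  noncomm_ring

/-- The coefficients `(-d⁻¹c)ⁿ d⁻¹` of the reciprocal of `l_{(c,d)}`. -/
def invSeries (c d : ℍ) : PowerSeries ℍ := PowerSeries.mk fun n => (-(d⁻¹ * c)) ^ n * d⁻¹

/-- For `|c| < |d|`, the reciprocal of `l_{(c,d)}` is defined on all of `𝔹`, it has the expected power
series, and it is the inverse of `l_{(c,d)}` for the regular product. -/
theorem starInv_lin {c d : ℍ} (h : ‖c‖ < ‖d‖) :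
    IsSliceSeries (starInv (lin c d)) (invSeries c d) ∧
      (∀ q : Ball, symmetrization (lin c d) q ≠ 0) ∧
      ∀ q : Ball, q * starInv (lin c d) q * c + starInv (lin c d) q * d = 1 := by
  have hd : d ≠ 0 := norm_pos_iff.1 ((norm_nonneg c).trans_lt h)
  obtain ⟨r, hr⟩ : ∃ r, r = -(d⁻¹ * c) := ⟨_, rfl⟩
  have hr1 : ‖r‖ < 1 := by
    rw [hr, norm_neg, norm_mul, norm_inv, inv_mul_lt_iff₀ (norm_pos_iff.2 hd), mul_one]
    exact h
  have hc : c = -(d * r) := by rw [hr, mul_neg, neg_neg, mul_inv_cancel_left₀ hd]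
  have hrt : r + star r = ((2 * r.re : ℝ) : ℍ) := by rw [Quaternion.self_add_star]; push_cast; rfl
  have hrm : r * star r = ((‖r‖ ^ 2 : ℝ) : ℍ) := Sp11.self_mul_star_eq r
  have hdN : d * star d = ((‖d‖ ^ 2 : ℝ) : ℍ) := Sp11.self_mul_star_eq d
  have hsc : star c = -(star r * star d) := by rw [hc]; simp
  have hN0 : ((‖d‖ ^ 2 : ℝ) : ℍ) ≠ 0 := by
    rw [← hdN]; exact mul_ne_zero hd (star_ne_zero.2 hd)
  generalize ‖d‖ ^ 2 = N at hdN hN0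
  generalize 2 * r.re = t at hrt
  generalize ‖r‖ ^ 2 = m at hrm
  have main : ∀ q : Ball, ∃ g : ℍ, HasSum (fun n : ℕ => (q : ℍ) ^ n * r ^ n) g ∧
      g - q * g * r = 1 ∧ symmetrization (lin c d) q ≠ 0 ∧
      starInv (lin c d) q = g * d⁻¹ := by
    intro q
    have hq := norm_lt_one q
    have hsum : Summable (fun n : ℕ => (q : ℍ) ^ n * r ^ n) := by
      refine Summable.of_norm_bounded (summable_geometric_of_lt_one (norm_nonneg r) hr1) fun n => ?_
      rw [norm_mul, norm_pow, norm_pow]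
      exact mul_le_of_le_one_left (by positivity) (pow_le_one₀ (norm_nonneg _) hq.le)
    obtain ⟨g, hg⟩ := hsum
    have hg1 : g - q * g * r = 1 := by
      have h1 : HasSum (fun n : ℕ => (q : ℍ) ^ (n + 1) * r ^ (n + 1)) (q * g * r) := by
        have := (hg.mul_left (q : ℍ)).mul_right r
        simpa only [pow_succ' (q : ℍ), pow_succ r, mul_assoc] using this
      have h2 := (hasSum_nat_add_iff (f := fun n : ℕ => (q : ℍ) ^ n * r ^ n) 1).1 h1
      have h3 := hg.unique h2
      simp only [Finset.sum_range_one, pow_zero, mul_one] at h3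
      rw [sub_eq_iff_eq_add, add_comm]
      exact h3
    have hS : symmetrization (lin c d) q = (N : ℍ) * (1 - t * q + m * q ^ 2) := by
      have e1 : c * star d + d * star c = -((t : ℍ) * N) := by
        rw [hsc, hc, ← hdN, ← hrt, hrt, ← mul_assoc, Quaternion.coe_commutes t d, ← hrt]
        noncomm_ring
      have e2 : c * star c = (m : ℍ) * N := by
        rw [hsc, hc, ← hdN, ← mul_assoc, Quaternion.coe_commutes m d, ← hrm]
        noncomm_ring
      rw [symmetrization_lin, hdN, e1, e2]
      have c1 : (q : ℍ) * (t * N) = N * (t * q) := by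
        rw [← mul_assoc, ← Quaternion.coe_commutes t, ← Quaternion.coe_commutes N]
      have c2 : (q : ℍ) ^ 2 * (m * N) = N * (m * q ^ 2) := by
        rw [← mul_assoc, ← Quaternion.coe_commutes m, ← Quaternion.coe_commutes N]
      rw [mul_neg, c1, c2]
      noncomm_ring
    have hDg : (1 - t * (q : ℍ) + m * (q : ℍ) ^ 2) * g = 1 - (q : ℍ) * star r := by
      have c1 : (t : ℍ) * q * g = q * g * (r + star r) := by
        rw [hrt, mul_assoc, Quaternion.coe_commutes]
      have c2 : (m : ℍ) * q ^ 2 * g = q ^ 2 * g * (r * star r) := by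
        rw [hrm, mul_assoc, Quaternion.coe_commutes]
      calc (1 - t * (q : ℍ) + m * (q : ℍ) ^ 2) * g = g - t * (q : ℍ) * g + m * (q : ℍ) ^ 2 * g := by noncomm_ring
        _ = (g - (q : ℍ) * g * r) - q * (g - q * g * r) * star r := by rw [c1, c2]; noncomm_ring
        _ = 1 - (q : ℍ) * star r := by rw [hg1, mul_one]
    have hD : (1 - t * q + m * q ^ 2 : ℍ) ≠ 0 := by
      intro h0
      rw [h0, zero_mul] at hDg
      have h1 : ‖(q : ℍ) * star r‖ = 1 := by rw [← sub_eq_zero.1 hDg.symm, norm_one]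
      rw [norm_mul, Quaternion.norm_star] at h1
      exact absurd h1 (mul_lt_one_of_nonneg_of_lt_one_left (norm_nonneg _) hq hr1.le).ne
    have hS0 : symmetrization (lin c d) q ≠ 0 := hS ▸ mul_ne_zero hN0 hD
    refine ⟨g, hg, hg1, hS0, ?_⟩
    rw [starInv, inv_mul_eq_iff_eq_mul₀ hS0, hS, regConj_lin, lin, hsc]
    have e : star d = (N : ℍ) * d⁻¹ := by
      rw [Quaternion.coe_commutes, ← hdN, inv_mul_cancel_left₀ hd]
    calc (q : ℍ) * -(star r * star d) + star d = (1 - q * star r) * star d := by noncomm_ring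
      _ = (1 - t * q + m * q ^ 2) * g * (N * d⁻¹) := by rw [hDg, e]
      _ = N * (1 - t * q + m * q ^ 2) * (g * d⁻¹) := by
        rw [← mul_assoc _ (N : ℍ), ← Quaternion.coe_commutes N]
        noncomm_ring
  refine ⟨fun q => ?_, fun q => ?_, fun q => ?_⟩
  · obtain ⟨g, hg, -, -, h4⟩ := main q
    have := hg.mul_right d⁻¹
    rw [h4]
    simpa only [invSeries, PowerSeries.coeff_mk, ← hr, mul_assoc] using this
  · exact (main q).choose_spec.2.2.1
  · obtain ⟨g, hg, h2, -, h4⟩ := main q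
    rw [h4, inv_mul_cancel_right₀ hd, ← h2, hr]
    noncomm_ring

/-! ### Regular Möbius transformations -/

/-- `l_{(c,d)}⁻* * l_{(a,b)}` for a matrix `A = (a, c; b, d)`. -/
def mobiusFun (A : Matrix (Fin 2) (Fin 2) ℍ) : Ball → ℍ :=
  starMul (starInv (lin (A 0 1) (A 1 1))) (lin (A 0 0) (A 1 0))

theorem mobiusFun_eq (A : Sp11) (q : Ball) : mobiusFun A q =
    starInv (lin (A.1 0 1) (A.1 1 1)) q * A.1 1 0
      + q * starInv (lin (A.1 0 1) (A.1 1 1)) q * A.1 0 0 := by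
  have h := (starInv_lin (Sp11.norm_01_lt A)).1
  rw [mobiusFun, starMul_eq h (isSliceSeries_lin _ _) (h.mul_lin _ _)]

theorem norm_mul_add_lt (A : Sp11) {p : ℍ} (hp : ‖p‖ < 1) :
    ‖p * A.1 0 0 + A.1 1 0‖ < ‖p * A.1 0 1 + A.1 1 1‖ := by
  obtain ⟨h1, h2, h3, h4⟩ := Sp11.row_entries A
  have key : (p * A.1 0 0 + A.1 1 0) * star (p * A.1 0 0 + A.1 1 0)
      - (p * A.1 0 1 + A.1 1 1) * star (p * A.1 0 1 + A.1 1 1) = p * star p - 1 := by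
    calc _ = p * (A.1 0 0 * star (A.1 0 0) - A.1 0 1 * star (A.1 0 1)) * star p
          + p * (A.1 0 0 * star (A.1 1 0) - A.1 0 1 * star (A.1 1 1))
          + (A.1 1 0 * star (A.1 0 0) - A.1 1 1 * star (A.1 0 1)) * star p
          + (A.1 1 0 * star (A.1 1 0) - A.1 1 1 * star (A.1 1 1)) := by
          simp only [star_add, star_mul]; noncomm_ring
      _ = p * star p - 1 := by rw [h1, h2, h3, h4]; simp [sub_eq_add_neg]
  simp only [Sp11.self_mul_star_eq] at key
  have key2 : ‖p * A.1 0 0 + A.1 1 0‖ ^ 2 - ‖p * A.1 0 1 + A.1 1 1‖ ^ 2 = ‖p‖ ^ 2 - 1 := by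
    refine Quaternion.coe_injective ?_
    push_cast at key ⊢
    exact key
  refine lt_of_pow_lt_pow_left₀ 2 (norm_nonneg _) ?_
  have : ‖p‖ ^ 2 < 1 := pow_lt_one₀ (norm_nonneg _) hp two_ne_zero
  linarith

/-- A regular Möbius transformation maps `𝔹` to `𝔹`. -/
theorem mobiusFun_mem (A : Sp11) (q : Ball) : mobiusFun A q ∈ Metric.ball (0 : ℍ) 1 := by
  rw [mem_ball_zero_iff, mobiusFun_eq]
  have h := (starInv_lin (Sp11.norm_01_lt A)).2.2 q
  generalize starInv (lin (A.1 0 1) (A.1 1 1)) q = G at h ⊢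
  have hG : G ≠ 0 := by rintro rfl; simp at h
  have hp : ‖G⁻¹ * q * G‖ < 1 := by
    rw [norm_mul, norm_mul, norm_inv, mul_right_comm, inv_mul_cancel₀ (norm_ne_zero_iff.2 hG),
      one_mul]
    exact norm_lt_one q
  have h1 := norm_mul_add_lt A hp
  have e : ∀ x y : ℍ, G * (G⁻¹ * q * G * x + y) = G * y + q * G * x := by
    intro x y
    rw [mul_add, mul_assoc, mul_assoc, mul_inv_cancel_left₀ hG, add_comm, mul_assoc]
  rw [← e]
  have h2 : G * (G⁻¹ * q * G * A.1 0 1 + A.1 1 1) = 1 := by rw [e, add_comm]; exact h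
  have h3 := congrArg norm h2
  rw [norm_mul, norm_one] at h3
  rw [norm_mul, ← h3]
  exact mul_lt_mul_of_pos_left h1 (norm_pos_iff.2 hG)

/-- The regular Möbius transformation `𝓕_A : 𝔹 → 𝔹`, `𝓕_A(q) = (qc + d)⁻* * (qa + b)`, of
`A = (a, c; b, d) ∈ Sp(1,1)`. -/
def mobius (A : Sp11) (q : Ball) : Ball := ⟨mobiusFun A q, mobiusFun_mem A q⟩

/-- The set of all regular Möbius transformations of `𝔹`. -/
def mobiusSet : Set (Ball → Ball) := Set.range mobius

/-- `𝓜(𝔹)`, the set of regular Möbius transformations, as a type.  It carries no topology by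
default. -/
def MB : Type := mobiusSet

namespace MB

instance : CoeFun MB (fun _ => Ball → Ball) := ⟨fun F => F.1⟩

/-- The map `Sp(1,1) → 𝓜(𝔹)`, `A ↦ 𝓕_{A⁻¹}`; its fibers are the cosets `A Sp(1)I₂`. -/
def proj (A : Sp11) : MB := ⟨mobius A⁻¹, A⁻¹, rfl⟩

/-- The manifold structure of `𝓜(𝔹) ≃ Sp(1,1)/Sp(1)I₂`: the smooth manifold structure, of dimension
`7`, with the quotient topology, for which `A ↦ 𝓕_{A⁻¹}` is a submersion, i.e. smooth and surjective
with surjective differential at every point. -/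
structure IsQuotientManifold [TopologicalSpace MB] [ChartedSpace (EuclideanSpace ℝ (Fin 7)) MB] :
    Prop where
  isManifold : IsManifold (𝓡 7) ∞ MB
  t2Space : T2Space MB
  secondCountableTopology : SecondCountableTopology MB
  isQuotientMap : Topology.IsQuotientMap proj
  contMDiff_proj : ContMDiff Sp11.model (𝓡 7) ∞ proj
  surjective_mfderiv : ∀ A : Sp11, Function.Surjective (mfderiv Sp11.model (𝓡 7) proj A)

/-- `𝓜(𝔹)₀`, the elements of `𝓜(𝔹)` that fix the origin. -/
def isotropy : Set MB := {F | F 0 = 0}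

end MB

/-- `R_u(q) = q u`. -/
def R (u : Sp1) (q : Ball) : Ball :=
  ⟨q * u, mem_ball_zero_iff.2 (by rw [norm_mul, norm_Sp1, mul_one]; exact norm_lt_one q)⟩

end RegMobius

end

/-! Everything is reduced to the coordinates `(b, w)` in `ℍ × Sp(1)`. The regular Möbius map of `A =
(a, c; b, d)` does not change when `A` is multiplied on the left by a unit quaternion, and each such
class has exactly one representative with `d` real and positive, namely `(s w, w b̄; b, s)` with `s
= √(1 + |b|²)`. So `ofCoord` maps `ℍ × Sp(1)` onto `𝓜(𝔹)`. It is injective: `𝓕(0) = b / s`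
determines `b`, and then the value of `𝓕` at the real point `1/2` determines `w`.

In these coordinates `proj` becomes `quo`, a smooth map with a smooth global section `sec v` for
each unit `v`. These sections pass through all points of `Sp(1,1)`, so `quo` is a submersion, and
the structure transported from `ℍ × Sp(1)` is as required. Conversely, for any structure that makes
`proj` a submersive quotient map, `ofCoord` is a smooth homeomorphism between manifolds of dimension
7 with surjective differentials. By the inverse function theorem it is a diffeomorphism
(`contMDiff_coordHomeo_symm`), so all remaining claims can be checked in coordinates.

The values of `𝓕_A` are computed from one fact: `𝓕_A(q) = G b + q G a`, where `G` is the only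
solution of `q G c + G d = 1` (`starInv_lin_eq`). When `q` commutes with `c` and `d`, this is the
classical fraction `(q c + d)⁻¹ (q a + b)`. Transitivity follows from an explicit matrix of this
kind. The isotropy at `0` is the slice `b = 0`, on which `𝓕` is `R_w`. -/

noncomputable section

namespace RegMobius

/-! ### Transport of manifold structures along homeomorphisms -/

section Transport

variable {E E' H H' X M : Type*} [NormedAddCommGroup E] [NormedSpace ℝ E]
  [NormedAddCommGroup E'] [NormedSpace ℝ E'] [TopologicalSpace H] [TopologicalSpace H']
  [TopologicalSpace X] [TopologicalSpace M] [ChartedSpace H X]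

/-- The charted space structure on `M` obtained from `X` along a homeomorphism of the spaces and a
homeomorphism of the model spaces. -/
@[reducible]
def transportChartedSpace (e : X ≃ₜ M) (L : H ≃ₜ H') : ChartedSpace H' M where
  atlas := {c' | ∃ c ∈ atlas H X, c' = e.symm.toOpenPartialHomeomorph ≫ₕ c ≫ₕ
    L.toOpenPartialHomeomorph}
  chartAt m := e.symm.toOpenPartialHomeomorph ≫ₕ chartAt H (e.symm m) ≫ₕ
    L.toOpenPartialHomeomorph
  mem_chart_source m := by simp
  chart_mem_atlas m := ⟨_, chart_mem_atlas _ _, rfl⟩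

variable {I : ModelWithCorners ℝ E H} {I' : ModelWithCorners ℝ E' H'}

/-- In a transition map the two copies of `e` cancel, which leaves a transition map of `X`
conjugated by `L`. -/
theorem isManifold_transport [IsManifold I ∞ X] (e : X ≃ₜ M) (L : H ≃ₜ H')
    (hL : ContMDiff I I' ∞ L) (hL' : ContMDiff I' I ∞ L.symm) :
    letI := transportChartedSpace e L
    IsManifold I' ∞ M := by
  let _ := transportChartedSpace e L
  have key : ∀ c ∈ atlas H X, ∀ c' ∈ atlas H X, ContMDiffOn I' I' ∞
      ((e.symm.toOpenPartialHomeomorph ≫ₕ c ≫ₕ L.toOpenPartialHomeomorph).symm ≫ₕ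
        (e.symm.toOpenPartialHomeomorph ≫ₕ c' ≫ₕ L.toOpenPartialHomeomorph))
      ((e.symm.toOpenPartialHomeomorph ≫ₕ c ≫ₕ L.toOpenPartialHomeomorph).symm ≫ₕ
        (e.symm.toOpenPartialHomeomorph ≫ₕ c' ≫ₕ L.toOpenPartialHomeomorph)).source := by
    intro c hc c' hc'
    have h1 := contMDiffOn_symm_of_mem_maximalAtlas (IsManifold.subset_maximalAtlas (I := I)
      (n := ∞) hc)
    have h2 := contMDiffOn_of_mem_maximalAtlas (IsManifold.subset_maximalAtlas (I := I)
      (n := ∞) hc')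
    have h3 := hL.comp_contMDiffOn (h2.comp' (h1.comp' (hL'.contMDiffOn (s := Set.univ))))
    refine (h3.congr ?_).mono ?_
    · intro y hy
      simp
    · intro y hy
      simpa [and_assoc] using hy
  refine isManifold_of_contDiffOn I' ∞ M ?_
  rintro _ _ ⟨c, hc, rfl⟩ ⟨c', hc', rfl⟩
  rw [← contMDiffOn_iff_contDiffOn]
  -- `key` lives on the model space `H'`; conjugation with `I'` carries it to the vector space `E'`.
  refine I'.contMDiff.comp_contMDiffOn ((key c hc c' hc').comp
    (I'.contMDiffOn_symm.mono Set.inter_subset_right) ?_)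
  intro y hy
  exact hy.1

/-- In the charts at `x` and `e x`, the map `e` reads as `L`. -/
theorem contMDiff_transport [IsManifold I ∞ X] (e : X ≃ₜ M) (L : H ≃ₜ H')
    (hL : ContMDiff I I' ∞ L) (hL' : ContMDiff I' I ∞ L.symm) :
    letI := transportChartedSpace e L
    ContMDiff I I' ∞ e ∧ ContMDiff I' I ∞ e.symm := by
  let _ := transportChartedSpace e L
  have := isManifold_transport e L hL hL'
  have hc : ∀ x : X, chartAt H' (e x) = e.symm.toOpenPartialHomeomorph ≫ₕ chartAt H x ≫ₕ
      L.toOpenPartialHomeomorph := by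
    intro x
    change e.symm.toOpenPartialHomeomorph ≫ₕ chartAt H (e.symm (e x)) ≫ₕ _ = _
    rw [e.symm_apply_apply]
  constructor
  · intro x
    have h1 := contMDiffOn_chart (I := I) (n := ∞) (x := x)
    have h2 := contMDiffOn_chart_symm (I := I') (n := ∞) (x := e x)
    have h3 := h2.comp' (hL.comp_contMDiffOn h1)
    rw [hc] at h3
    refine (h3.congr (f₁ := e) ?_).contMDiffAt ?_
    · rintro y ⟨hy, -⟩
      simp [(chartAt H x).left_inv hy]
    · refine Filter.mem_of_superset ((chartAt H x).open_source.mem_nhds (mem_chart_source H x)) ?_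
      intro y hy
      simp [hy, (chartAt H x).map_source hy]
  · intro m
    obtain ⟨x, rfl⟩ := e.surjective m
    have h1 := contMDiffOn_chart_symm (I := I) (n := ∞) (x := x)
    have h2 := contMDiffOn_chart (I := I') (n := ∞) (x := e x)
    have h3 := h1.comp' (hL'.comp_contMDiffOn h2)
    rw [hc] at h3
    refine (h3.congr (f₁ := e.symm) ?_).contMDiffAt ?_
    · rintro y ⟨hy, -⟩
      have : e.symm y ∈ (chartAt H x).source := by simpa using hy
      simp [(chartAt H x).left_inv this]
    · have ho : IsOpen (e.symm ⁻¹' (chartAt H x).source) :=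
        (chartAt H x).open_source.preimage e.symm.continuous
      refine Filter.mem_of_superset (ho.mem_nhds (by simp)) ?_
      intro y hy
      have : e.symm y ∈ (chartAt H x).source := hy
      simp [this, (chartAt H x).map_source this]

end Transport

/-! ### Smooth inverses from the inverse function theorem -/

section InverseFunction

variable {E E' H H' X M : Type*} [NormedAddCommGroup E] [NormedSpace ℝ E]
  [NormedAddCommGroup E'] [NormedSpace ℝ E'] [TopologicalSpace H] [TopologicalSpace H']
  [TopologicalSpace X] [TopologicalSpace M] [ChartedSpace H X] [ChartedSpace H' M]
  [FiniteDimensional ℝ E] [FiniteDimensional ℝ E']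

/-- A smooth homeomorphism of manifolds of the same dimension whose differential is everywhere
surjective has a smooth inverse. -/
theorem contMDiff_symm_of_surjective_mfderiv {I : ModelWithCorners ℝ E H}
    {I' : ModelWithCorners ℝ E' H'} [I.Boundaryless] [I'.Boundaryless]
    (hdim : Module.finrank ℝ E = Module.finrank ℝ E') (e : X ≃ₜ M) (he : ContMDiff I I' ∞ e)
    (hd : ∀ x, Function.Surjective (mfderiv I I' e x)) : ContMDiff I' I ∞ e.symm := by
  have : CompleteSpace E := FiniteDimensional.complete ℝ E
  intro m
  obtain ⟨x, rfl⟩ := e.surjective m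
  -- `e` in charts, kept as a partial homeomorphism of vector spaces, so that the continuous inverse
  -- is already at hand and only its smoothness remains. Without boundary, `I` and `I'` are
  -- homeomorphisms.
  let f : OpenPartialHomeomorph E E' := I.toHomeomorph.symm.toOpenPartialHomeomorph ≫ₕ
    (chartAt H x).symm ≫ₕ e.toOpenPartialHomeomorph ≫ₕ chartAt H' (e x) ≫ₕ
    I'.toHomeomorph.toOpenPartialHomeomorph
  have hf : ∀ y, f y = writtenInExtChartAt I I' x e y := fun y => rfl
  have hfs : ∀ y, f.symm y = extChartAt I x (e.symm ((extChartAt I' (e x)).symm y)) := fun y => rfl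
  have h1 : ContDiffAt ℝ ∞ f (extChartAt I x x) := by
    have := (contMDiffAt_iff.1 (he x)).2
    rw [I.range_eq_univ, contDiffWithinAt_univ] at this
    exact this
  have h2 : Function.Surjective (fderiv ℝ f (extChartAt I x x)) := by
    have := hd x
    rw [((he x).mdifferentiableAt (by simp)).mfderiv, I.range_eq_univ, fderivWithin_univ] at this
    exact this
  have h3 : Function.Injective (fderiv ℝ f (extChartAt I x x)) :=
    (LinearMap.injective_iff_surjective_of_finrank_eq_finrank hdim).2 h2
  let f' : E ≃L[ℝ] E' := ContinuousLinearEquiv.ofBijective (fderiv ℝ f (extChartAt I x x))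
    (LinearMap.ker_eq_bot.2 h3) (LinearMap.range_eq_top.2 h2)
  have ha : f.symm (extChartAt I' (e x) (e x)) = extChartAt I x x := by
    rw [hfs]; simp
  rw [contMDiffAt_iff]
  refine ⟨e.symm.continuous.continuousAt, ?_⟩
  rw [I'.range_eq_univ, contDiffWithinAt_univ]
  have h4 : ContDiffAt ℝ ∞ f.symm (extChartAt I' (e x) (e x)) := by
    refine f.contDiffAt_symm (f₀' := f') ?_ ?_ ?_
    · simp [f]
    · rw [ha]
      exact (h1.differentiableAt (by simp)).hasFDerivAt
    · rw [ha]; exact h1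
  rw [e.symm_apply_apply]
  exact h4

end InverseFunction

/-! ### Computing values of regular Möbius transformations -/

section Formula

/-- The difference `Δ` of two solutions satisfies `q Δ c = -Δ d`. Taking norms, `|q| |c| < |d|`
forces `Δ = 0`. -/
theorem starInv_lin_eq {c d : ℍ} (h : ‖c‖ < ‖d‖) (q : Ball) {G : ℍ}
    (hG : q * G * c + G * d = 1) : starInv (lin c d) q = G := by
  have h1 := (starInv_lin h).2.2 q
  generalize starInv (lin c d) q = K at h1
  by_contra hne
  have h2 : (q : ℍ) * (K - G) * c = -((K - G) * d) := by
    have : (q : ℍ) * (K - G) * c + (K - G) * d = 0 := by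
      calc _ = ((q : ℍ) * K * c + K * d) - (q * G * c + G * d) := by noncomm_ring
        _ = 0 := by rw [h1, hG, sub_self]
    exact eq_neg_of_add_eq_zero_left this
  have h3 := congrArg norm h2
  rw [norm_neg, norm_mul, norm_mul, norm_mul] at h3
  have h4 : 0 < ‖K - G‖ := norm_pos_iff.2 (sub_ne_zero.2 hne)
  have h5 := norm_lt_one q
  nlinarith [norm_nonneg c, norm_nonneg (q : ℍ), mul_pos h4 (sub_pos.2 h),
    mul_nonneg (mul_nonneg h4.le (norm_nonneg c)) (sub_nonneg.2 h5.le)]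

theorem mobius_apply_of_eq (A : Sp11) (q : Ball) {G : ℍ}
    (hG : q * G * A.1 0 1 + G * A.1 1 1 = 1) :
    (mobius A q : ℍ) = G * A.1 1 0 + q * G * A.1 0 0 := by
  change mobiusFun A q = _
  rw [mobiusFun_eq, starInv_lin_eq (Sp11.norm_01_lt A) q hG]

/-- If `q` commutes with the first column of `A`, then `𝓕_A(q)` satisfies
`(q c + d) 𝓕_A(q) = q a + b`. -/
theorem mobius_mul_eq (A : Sp11) (q : Ball) (h : Commute (q : ℍ) (A.1 0 1))
    (h' : Commute (q : ℍ) (A.1 1 1)) :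
    (q * A.1 0 1 + A.1 1 1) * (mobius A q : ℍ) = q * A.1 0 0 + A.1 1 0 := by
  have hD : (q : ℍ) * A.1 0 1 + A.1 1 1 ≠ 0 := by
    intro h0
    have := norm_mul_add_lt A (norm_lt_one q)
    rw [h0, norm_zero] at this
    exact absurd this (norm_nonneg _).not_gt
  -- As `q` commutes with both entries `c`, `d` of the second column, it commutes with `G = (q c +
  -- d)⁻¹`, which therefore solves `q G c + G d = 1`.
  have hq : Commute (q : ℍ) (q * A.1 0 1 + A.1 1 1)⁻¹ :=
    (((Commute.refl _).mul_right h).add_right h').inv_right₀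
  rw [mobius_apply_of_eq A q (G := (q * A.1 0 1 + A.1 1 1)⁻¹) ?_, hq.eq, mul_assoc, ← mul_add,
    mul_inv_cancel_left₀ hD, add_comm]
  rw [hq.eq, mul_assoc, ← mul_add, inv_mul_cancel₀ hD]

/-- If `G` solves the equation for `A`, then `G v⁻¹` solves it for `B`, and the factor `v` cancels
in the value. This makes the Möbius map depend only on the class of the matrix. -/
theorem mobius_eq_of_mul_left {A B : Sp11} {v : ℍ} (hv : v ≠ 0)
    (h : ∀ i j, B.1 i j = v * A.1 i j) : mobius B = mobius A := by
  funext q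
  refine Subtype.ext ?_
  have hA := (starInv_lin (Sp11.norm_01_lt A)).2.2 q
  have e : ∀ G x : ℍ, G * v⁻¹ * (v * x) = G * x := by
    intro G x
    rw [mul_assoc, inv_mul_cancel_left₀ hv]
  rw [mobius_apply_of_eq A q hA, mobius_apply_of_eq B q
    (G := starInv (lin (A.1 0 1) (A.1 1 1)) q * v⁻¹)]
  · rw [h, h, e, ← mul_assoc (q : ℍ), e]
  · rw [h, h, e, ← mul_assoc (q : ℍ), e]
    exact hA

theorem mobius_zero (A : Sp11) : (mobius A 0 : ℍ) = (A.1 1 1)⁻¹ * A.1 1 0 := by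
  have h : A.1 1 1 ≠ 0 := norm_pos_iff.1 (Sp11.norm_pos A).2
  rw [mobius_apply_of_eq A 0 (G := (A.1 1 1)⁻¹)]
  · simp
  · simp [h]

end Formula

/-! ### The Lie group `Sp(1)` -/

section UnitSphere

theorem star_Sp1 (u : Sp1) : star (u : ℍ) = ((u⁻¹ : Sp1) : ℍ) := by
  have h : (u : ℍ) * star (u : ℍ) = 1 := by rw [Sp11.self_mul_star_eq]; simp
  rw [Metric.unitSphere.coe_inv, eq_inv_of_mul_eq_one_right h]

theorem _root_.ContMDiff.quaternion_mul {E H N : Type*} [NormedAddCommGroup E] [NormedSpace ℝ E]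
    [TopologicalSpace H] {I : ModelWithCorners ℝ E H} [TopologicalSpace N] [ChartedSpace H N]
    {f g : N → ℍ} (hf : ContMDiff I 𝓘(ℝ, ℍ) ∞ f) (hg : ContMDiff I 𝓘(ℝ, ℍ) ∞ g) :
    ContMDiff I 𝓘(ℝ, ℍ) ∞ fun x => f x * g x :=
  (contDiff_mul (𝕜 := ℝ) (𝔸 := ℍ)).contMDiff.comp (hf.prodMk_space hg)

theorem contMDiff_star : ContMDiff 𝓘(ℝ, ℍ) 𝓘(ℝ, ℍ) ∞ (star : ℍ → ℍ) :=
  (LinearMap.toContinuousLinearMap (⟨⟨star, star_add⟩, Quaternion.star_smul⟩ :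
    ℍ →ₗ[ℝ] ℍ)).contDiff.contMDiff

/-- `Sp(1)` is a Lie group. -/
instance : LieGroup (𝓡 3) ∞ Sp1 where
  contMDiff_mul := by
    have h : ContMDiff ((𝓡 3).prod (𝓡 3)) 𝓘(ℝ, ℍ) ∞ fun x : Sp1 × Sp1 => (x.1 : ℍ) * (x.2 : ℍ) :=
      (contMDiff_coe_sphere.comp contMDiff_fst).quaternion_mul (contMDiff_coe_sphere.comp contMDiff_snd)
    exact h.codRestrict_sphere fun x => (x.1 * x.2).2
  contMDiff_inv := by
    have h : ContMDiff (𝓡 3) 𝓘(ℝ, ℍ) ∞ fun x : Sp1 => ((x⁻¹ : Sp1) : ℍ) := by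
      simp only [← star_Sp1]
      exact contMDiff_star.comp contMDiff_coe_sphere
    exact h.codRestrict_sphere fun x => (x⁻¹).2

end UnitSphere

/-! ### The quotient map and its sections in coordinates -/

section Coordinates

/-- The space of coordinates of `𝓜(𝔹)`. -/
abbrev Coord : Type := ℍ × Sp1

/-- The model with corners of the space of coordinates. -/
abbrev coordModel : ModelWithCorners ℝ (ℍ × EuclideanSpace ℝ (Fin 3))
    (ModelProd ℍ (EuclideanSpace ℝ (Fin 3))) := 𝓘(ℝ, ℍ).prod (𝓡 3)

/-- The coordinates of the class of `A` in `Sp(1,1)/Sp(1)I₂`. -/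
def quo (A : Sp11) : Coord :=
  ((((Sp11.homeo A⁻¹).2.2⁻¹ : Sp1) : ℍ) * (Sp11.homeo A⁻¹).1,
    (Sp11.homeo A⁻¹).2.2⁻¹ * (Sp11.homeo A⁻¹).2.1)

/-- A family of sections of `quo`, whose images cover `Sp(1,1)`. -/
def sec (v : Sp1) (x : Coord) : Sp11 := (Sp11.homeo.symm (v * x.1, v * x.2, v))⁻¹

theorem quo_sec (v : Sp1) (x : Coord) : quo (sec v x) = x := by
  simp only [quo, sec, inv_inv, Homeomorph.apply_symm_apply, inv_mul_cancel_left]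
  refine Prod.ext ?_ rfl
  rw [← mul_assoc, ← Metric.unitSphere.coe_mul]
  simp

/-- The only datum lost by `quo` is the phase of the entry `d` of `A⁻¹`; taken as parameter, it
selects the section through `A`. -/
theorem sec_quo (A : Sp11) : sec (Sp11.homeo A⁻¹).2.2 (quo A) = A := by
  rw [sec, quo, inv_eq_iff_eq_inv, Homeomorph.symm_apply_eq]
  refine Prod.ext ?_ (Prod.ext ?_ rfl)
  · change _ * (_ * _) = _
    rw [← mul_assoc, ← Metric.unitSphere.coe_mul, mul_inv_cancel, Metric.unitSphere.coe_one,
      one_mul]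
  · simp

/-- Since `A⁻¹ = J A* J`, the entries of the inverse are conjugates of entries of `A`, up to sign.
-/
theorem Sp11.contMDiff_inv : ContMDiff Sp11.model Sp11.model ∞ fun A : Sp11 => A⁻¹ := by
  rw [Sp11.contMDiff_iff]
  intro i j
  have h : ∀ i j, ContMDiff Sp11.model 𝓘(ℝ, ℍ) ∞ fun A : Sp11 => star (A.1 i j) := fun i j =>
    contMDiff_star.comp (Sp11.contMDiff_entry i j)
  have h' : ∀ i j, ContMDiff Sp11.model 𝓘(ℝ, ℍ) ∞ fun A : Sp11 => -star (A.1 i j) := fun i j =>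
    (h i j).neg
  simp only [Sp11.coe_inv, Matrix.mul_apply, Fin.sum_univ_two, Matrix.conjTranspose_apply]
  fin_cases i <;> fin_cases j <;> simp [J, h, h']

theorem contMDiff_quo : ContMDiff Sp11.model coordModel ∞ quo := by
  have h := Sp11.contMDiff_homeo.comp Sp11.contMDiff_inv
  have h1 := contMDiff_fst.comp h
  have h2 := contMDiff_fst.comp (contMDiff_snd.comp h)
  have h3 := (contMDiff_snd.comp (contMDiff_snd.comp h)).inv
  exact ((contMDiff_coe_sphere.comp h3).quaternion_mul h1).prodMk (h3.mul h2)

theorem contMDiff_sec (v : Sp1) : ContMDiff coordModel Sp11.model ∞ (sec v) := by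
  refine Sp11.contMDiff_inv.comp ?_
  rw [Sp11.contMDiff_iff_homeo]
  simp only [Homeomorph.apply_symm_apply]
  exact (contMDiff_const.quaternion_mul contMDiff_fst).prodMk
    ((contMDiff_const.mul contMDiff_snd).prodMk contMDiff_const)

end Coordinates

/-! ### The coordinates `(b, w)` on `𝓜(𝔹)` -/

namespace MB

/-- The regular Möbius transformation with coordinates `(b, w)`. -/
def ofCoord (x : Coord) : MB := ⟨mobius (Sp11.homeo.symm (x.1, x.2, 1)), _, rfl⟩

theorem coord_entries (x : Coord) :
    (Sp11.homeo.symm (x.1, x.2, 1)).1 0 0 = √(1 + ‖x.1‖ ^ 2) • (x.2 : ℍ) ∧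
    (Sp11.homeo.symm (x.1, x.2, 1)).1 0 1 = x.2 * star x.1 ∧
    (Sp11.homeo.symm (x.1, x.2, 1)).1 1 0 = x.1 ∧
    (Sp11.homeo.symm (x.1, x.2, 1)).1 1 1 = (√(1 + ‖x.1‖ ^ 2) : ℝ) := by
  refine ⟨rfl, mul_one _, rfl, ?_⟩
  change √(1 + ‖x.1‖ ^ 2) • (1 : ℍ) = _
  rw [← Quaternion.coe_mul_eq_smul, mul_one]

/-- The matrices with parameters `(v b, v w, v)` and `(b, w, 1)` differ by the left factor `v`. -/
theorem proj_sec (v : Sp1) (x : Coord) : proj (sec v x) = ofCoord x := by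
  refine Subtype.ext ?_
  change mobius (sec v x)⁻¹ = _
  rw [sec, inv_inv]
  have hv : star (v : ℍ) * v = 1 := by rw [Sp11.star_mul_self_eq]; simp
  have hs : ‖(v : ℍ) * x.1‖ = ‖x.1‖ := by rw [norm_mul, norm_Sp1, one_mul]
  refine mobius_eq_of_mul_left (v := v) (norm_pos_iff.1 (by simp)) fun i j => ?_
  change Sp11.paramMatrix _ i j = _ * Sp11.paramMatrix _ i j
  fin_cases i <;> fin_cases j <;> simp [Sp11.paramMatrix, hs, mul_assoc, hv]

theorem ofCoord_quo (A : Sp11) : ofCoord (quo A) = proj A := by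
  rw [← proj_sec (Sp11.homeo A⁻¹).2.2, sec_quo]

theorem ofCoord_surjective : Function.Surjective ofCoord := by
  rintro ⟨_, A, rfl⟩
  refine ⟨quo A⁻¹, (ofCoord_quo _).trans (Subtype.ext ?_)⟩
  exact congrArg mobius (inv_inv A)

theorem ofCoord_zero (x : Coord) : (ofCoord x 0 : ℍ) = (√(1 + ‖x.1‖ ^ 2))⁻¹ • x.1 := by
  refine (mobius_zero _).trans ?_
  obtain ⟨-, -, h1, h2⟩ := coord_entries x
  rw [h1, h2, ← Quaternion.coe_inv, Quaternion.coe_mul_eq_smul]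

/-- The squared norm of `b / √(1 + |b|²)` is `1 - 1 / (1 + |b|²)`, which determines `|b|` and hence
the scalar factor. -/
theorem eq_of_sqrt_smul_eq {b b' : ℍ}
    (h : (√(1 + ‖b‖ ^ 2))⁻¹ • b = (√(1 + ‖b'‖ ^ 2))⁻¹ • b') : b = b' := by
  have h1 : ∀ b : ℍ, 0 < √(1 + ‖b‖ ^ 2) := fun b => Real.sqrt_pos.2 (by positivity)
  have h2 : ∀ b : ℍ, ‖(√(1 + ‖b‖ ^ 2))⁻¹ • b‖ ^ 2 = 1 - (1 + ‖b‖ ^ 2)⁻¹ := by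
    intro b
    rw [norm_smul, norm_inv, Real.norm_of_nonneg (h1 b).le, mul_pow, inv_pow,
      Real.sq_sqrt (by positivity)]
    field_simp
    ring
  have h3 : 1 + ‖b‖ ^ 2 = 1 + ‖b'‖ ^ 2 := by
    have := h2 b
    rw [h, h2 b', sub_right_inj, inv_inj] at this
    exact this.symm
  rw [h3] at h
  exact smul_right_injective ℍ (inv_ne_zero (h1 b').ne') h

theorem ofCoord_injective : Function.Injective ofCoord := by
  rintro ⟨b, w⟩ ⟨b', w'⟩ h
  obtain rfl : b = b' := by
    have h0 := congrArg (fun F : MB => (F 0 : ℍ)) h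
    simp only [ofCoord_zero] at h0
    exact eq_of_sqrt_smul_eq h0
  have hq : ‖((2⁻¹ : ℝ) : ℍ)‖ < 1 := by
    rw [Quaternion.norm_coe]; norm_num
  obtain ⟨s, hs⟩ : ∃ s, s = √(1 + ‖b‖ ^ 2) := ⟨_, rfl⟩
  have hs1 : ‖b‖ < s := hs ▸ Real.lt_sqrt_of_sq_lt (by linarith)
  obtain ⟨F, hF⟩ : ∃ F, F = ofCoord (b, w') ⟨((2⁻¹ : ℝ) : ℍ), mem_ball_zero_iff.2 hq⟩ := ⟨_, rfl⟩
  -- The relation `(q c + d) F = q a + b` at `q = 1/2`, solved for the terms with `u`. A real `q`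
  -- commutes with every entry, and a nonzero one keeps `u` in the equation.
  have key : ∀ u : Sp1, ofCoord (b, u) = ofCoord (b, w') →
      ((2⁻¹ : ℝ) : ℍ) * (u * (s - star b * F)) = s * F - b := by
    intro u hu
    have h1 := mobius_mul_eq (Sp11.homeo.symm (b, u, 1))
      ⟨((2⁻¹ : ℝ) : ℍ), mem_ball_zero_iff.2 hq⟩ (Quaternion.coe_commute _ _)
      (Quaternion.coe_commute _ _)
    obtain ⟨e1, e2, e3, e4⟩ := coord_entries (b, u)
    have h2 : mobius (Sp11.homeo.symm (b, u, 1)) ⟨((2⁻¹ : ℝ) : ℍ), mem_ball_zero_iff.2 hq⟩ = F := by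
      rw [hF, ← hu]; rfl
    rw [e1, e2, e3, e4, h2, ← hs, ← Quaternion.coe_mul_eq_smul, Quaternion.coe_commutes s] at h1
    have h5 : ((2⁻¹ : ℝ) : ℍ) * (u * (s - star b * F)) =
        ((2⁻¹ : ℝ) : ℍ) * (u * s) + b - (((2⁻¹ : ℝ) : ℍ) * (u * star b) + s) * F + s * F - b := by
      noncomm_ring
    rw [h5, ← h1]
    noncomm_ring
  have h1 := (key w h).trans (key w' rfl).symm
  -- The factor to the right of `u` can be cancelled because `|b| < s` and `|F| < 1`.
  have h2 : (s - star b * F : ℍ) ≠ 0 := by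
    intro h0
    have h3 : ‖(s : ℍ)‖ = ‖star b * F‖ := congrArg norm (sub_eq_zero.1 h0)
    rw [Quaternion.norm_coe, norm_mul, norm_star, Real.norm_of_nonneg
      ((norm_nonneg b).trans hs1.le)] at h3
    nlinarith [norm_lt_one F, norm_nonneg b, norm_nonneg (F : ℍ)]
  have h3 : ((2⁻¹ : ℝ) : ℍ) ≠ 0 := by
    rw [← norm_pos_iff, Quaternion.norm_coe]; norm_num
  exact Prod.ext rfl (Subtype.ext (mul_right_cancel₀ h2 (mul_left_cancel₀ h3 h1)))

end MB

/-! ### Smooth dependence on the matrix and the point -/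

section Evaluation

theorem contDiffAt_quaternion_inv {x : ℍ} (hx : x ≠ 0) :
    ContDiffAt ℝ ∞ (fun y : ℍ => y⁻¹) x := by
  have h := contDiffAt_ringInverse ℝ (n := ∞) (Units.mk0 x hx)
  simpa only [Ring.inverse_eq_inv', Units.val_mk0] using! h

/-- `𝓕_A(q)` depends smoothly on `A` and `q`. -/
theorem contMDiff_mobius : ContMDiff (Sp11.model.prod 𝓘(ℝ, ℍ)) 𝓘(ℝ, ℍ) ∞
    fun x : Sp11 × Ball => mobius x.1 x.2 := by
  rw [← ContMDiff.subtypeVal_comp_iff]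
  have hA : ∀ i j, ContMDiff (Sp11.model.prod 𝓘(ℝ, ℍ)) 𝓘(ℝ, ℍ) ∞
      fun x : Sp11 × Ball => x.1.1 i j := fun i j =>
    (Sp11.contMDiff_entry i j).comp contMDiff_fst
  have hS : ∀ i j, ContMDiff (Sp11.model.prod 𝓘(ℝ, ℍ)) 𝓘(ℝ, ℍ) ∞
      fun x : Sp11 × Ball => star (x.1.1 i j) := fun i j => contMDiff_star.comp (hA i j)
  have hq : ContMDiff (Sp11.model.prod 𝓘(ℝ, ℍ)) 𝓘(ℝ, ℍ) ∞
      fun x : Sp11 × Ball => (x.2 : ℍ) := contMDiff_subtype_val.comp contMDiff_snd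
  -- The symmetrization is a polynomial in `q`, `c`, `d` and the conjugates of `c`, `d`. It has no
  -- zeros on the ball because `|c| < |d|`, so its inverse is smooth too.
  have hD : ContMDiff (Sp11.model.prod 𝓘(ℝ, ℍ)) 𝓘(ℝ, ℍ) ∞
      fun x : Sp11 × Ball => symmetrization (lin (x.1.1 0 1) (x.1.1 1 1)) x.2 := by
    simp only [symmetrization_lin, sq]
    exact (((hA 1 1).quaternion_mul (hS 1 1)).add (hq.quaternion_mul
      (((hA 0 1).quaternion_mul (hS 1 1)).add ((hA 1 1).quaternion_mul (hS 0 1))))).add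
      ((hq.quaternion_mul hq).quaternion_mul ((hA 0 1).quaternion_mul (hS 0 1)))
  have hI : ContMDiff (Sp11.model.prod 𝓘(ℝ, ℍ)) 𝓘(ℝ, ℍ) ∞
      fun x : Sp11 × Ball => (symmetrization (lin (x.1.1 0 1) (x.1.1 1 1)) x.2)⁻¹ := fun x =>
    (contDiffAt_quaternion_inv ((starInv_lin (Sp11.norm_01_lt x.1)).2.1 x.2)).contMDiffAt.comp x
      (hD x)
  have hG : ContMDiff (Sp11.model.prod 𝓘(ℝ, ℍ)) 𝓘(ℝ, ℍ) ∞
      fun x : Sp11 × Ball => starInv (lin (x.1.1 0 1) (x.1.1 1 1)) x.2 := by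
    simp only [starInv, regConj_lin, lin]
    exact hI.quaternion_mul ((hq.quaternion_mul (hS 0 1)).add (hS 1 1))
  refine ((hG.quaternion_mul (hA 1 0)).add ((hq.quaternion_mul hG).quaternion_mul (hA 0 0))).congr
    fun x => ?_
  exact mobiusFun_eq x.1 x.2

end Evaluation

/-! ### Transitivity on the ball -/

section Transitivity

/-- The matrix `(t u, z̄; z u, t)` belongs to `Sp(1,1)` if `t² - |z|² = 1`. -/
theorem mem_Sp11_of_sq_sub_eq_one {t : ℝ} {z : ℍ} (u : Sp1) (h : t ^ 2 - ‖z‖ ^ 2 = 1) :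
    (!![(t : ℍ) * u, star z; z * u, (t : ℍ)] : Matrix (Fin 2) (Fin 2) ℍ) ∈ Sp11 := by
  rw [Sp11.mem_iff_entries]
  have h' : ((t ^ 2 : ℝ) : ℍ) - ((‖z‖ ^ 2 : ℝ) : ℍ) = 1 := by
    rw [← Quaternion.coe_sub, h, Quaternion.coe_one]
  refine ⟨?_, ?_, ?_, ?_⟩
  · change star ((t : ℍ) * u) * ((t : ℍ) * u) - star (z * u) * (z * u) = 1
    rw [Sp11.star_mul_self_eq, Sp11.star_mul_self_eq, norm_mul, norm_mul, norm_Sp1, mul_one,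
      mul_one, Quaternion.norm_coe, Real.norm_eq_abs, sq_abs, h']
  · change star ((t : ℍ) * u) * star z - star (z * u) * (t : ℍ) = 0
    rw [star_mul, star_mul, Quaternion.star_coe, mul_assoc, mul_assoc, Quaternion.coe_commutes,
      sub_self]
  · change star (star z) * ((t : ℍ) * u) - star (t : ℍ) * (z * u) = 0
    rw [star_star, Quaternion.star_coe, ← mul_assoc, ← mul_assoc, Quaternion.coe_commutes,
      sub_self]
  · change star (star z) * star z - star (t : ℍ) * (t : ℍ) = -1
    rw [Sp11.star_mul_self_eq, Sp11.star_mul_self_eq, norm_star, Quaternion.norm_coe,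
      Real.norm_eq_abs, sq_abs, ← neg_sub, h']

theorem exists_eq_norm_mul (q : ℍ) : ∃ u : Sp1, q = (‖q‖ : ℝ) * (u : ℍ) := by
  by_cases hq : q = 0
  · exact ⟨1, by simp [hq]⟩
  · refine ⟨⟨‖q‖⁻¹ • q, Sp11.normalize_mem (norm_pos_iff.2 hq)⟩, ?_⟩
    rw [Quaternion.coe_mul_eq_smul, smul_smul, mul_inv_cancel₀ (norm_ne_zero_iff.2 hq), one_smul]

/-- The regular Möbius transformations act transitively on the ball. -/
theorem exists_mobius_apply_eq (p q : Ball) : ∃ A : Sp11, mobius A p = q := by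
  obtain ⟨u, hu⟩ := exists_eq_norm_mul (q : ℍ)
  have hp := norm_lt_one p
  have hq := norm_lt_one q
  have hp0 := norm_nonneg (p : ℍ)
  have hq0 := norm_nonneg (q : ℍ)
  have hpp : (p : ℍ) * star (p : ℍ) = ((‖(p : ℍ)‖ ^ 2 : ℝ) : ℍ) := Sp11.self_mul_star_eq _
  generalize hr : ‖(q : ℍ)‖ = r at hu hq hq0
  generalize hm : ‖(p : ℍ)‖ = m at hp hp0 hpp
  have hrm : r * m < 1 := by nlinarith
  -- With `q = r u`, the matrix `(t u, z̄; z u, t)` sends `p` to `q` when `(p z̄ + t) r = p t + z`,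
  -- provided `p` commutes with `z̄`. Solving this together with its conjugate, and scaling so that
  -- `t` is `D = 1 - r² m²`, gives `z = y`.
  obtain ⟨y, hy⟩ : ∃ y : ℍ, y = (r * (1 - m ^ 2) : ℝ) - (1 - r ^ 2 : ℝ) * (p : ℍ) := ⟨_, rfl⟩
  have hyD : ‖y‖ < 1 - r ^ 2 * m ^ 2 := by
    have h1 : ‖y‖ ≤ r * (1 - m ^ 2) + (1 - r ^ 2) * m := by
      rw [hy]
      refine (norm_sub_le _ _).trans_eq ?_
      rw [norm_mul, Quaternion.norm_coe, Quaternion.norm_coe, hm,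
        Real.norm_of_nonneg (mul_nonneg hq0 (by nlinarith)), Real.norm_of_nonneg (by nlinarith)]
    -- The gap between `D` and the bound is exactly `(1 - r m)(1 - m)(1 - r)`.
    nlinarith [mul_pos (sub_pos.2 hrm) (mul_pos (sub_pos.2 hp) (sub_pos.2 hq))]
  generalize hD : 1 - r ^ 2 * m ^ 2 = D at hyD
  have hpos : 0 < D ^ 2 - ‖y‖ ^ 2 := by nlinarith [norm_nonneg y]
  -- The equation is homogeneous in `(t, z)`; the real factor `k` normalizes the matrix into
  -- `Sp(1,1)`.
  obtain ⟨k, hk0, hk⟩ : ∃ k : ℝ, 0 < k ∧ k ^ 2 * (D ^ 2 - ‖y‖ ^ 2) = 1 := by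
    refine ⟨(√(D ^ 2 - ‖y‖ ^ 2))⁻¹, inv_pos.2 (Real.sqrt_pos.2 hpos), ?_⟩
    rw [inv_pow, Real.sq_sqrt hpos.le, inv_mul_cancel₀ hpos.ne']
  have hmem := mem_Sp11_of_sq_sub_eq_one (t := k * D) (z := (k : ℍ) * y) u (by
    rw [norm_mul, Quaternion.norm_coe, mul_pow, mul_pow, Real.norm_eq_abs, sq_abs, ← mul_sub, hk])
  have hsy : star y = (r * (1 - m ^ 2) : ℝ) - star (p : ℍ) * (1 - r ^ 2 : ℝ) := by
    rw [hy, star_sub, star_mul, Quaternion.star_coe, Quaternion.star_coe]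
  -- `ȳ` is a real combination of `1` and `p̄`, and `p` commutes with `p̄`.
  have hcomm : Commute (p : ℍ) (star y) := by
    have h1 : Commute (p : ℍ) (star (p : ℍ)) := by
      rw [Commute, SemiconjBy, hpp, Sp11.star_mul_self_eq, hm]
    rw [hsy]
    exact (Quaternion.coe_commute _ _).symm.sub_right
      (h1.mul_right (Quaternion.coe_commute _ _).symm)
  have hc1 : Commute (p : ℍ) (star ((k : ℍ) * y)) := by
    rw [star_mul, Quaternion.star_coe]
    exact hcomm.mul_right (Quaternion.coe_commute _ _).symm
  refine ⟨⟨_, hmem⟩, Subtype.ext ?_⟩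
  have h1 := mobius_mul_eq ⟨_, hmem⟩ p hc1 (Quaternion.coe_commute _ _).symm
  have h2 : (p : ℍ) * star ((k : ℍ) * y) + ((k * D : ℝ) : ℍ) ≠ 0 := by
    intro h0
    have := norm_mul_add_lt ⟨_, hmem⟩ (norm_lt_one p)
    change _ < ‖(p : ℍ) * star ((k : ℍ) * y) + ((k * D : ℝ) : ℍ)‖ at this
    rw [h0, norm_zero] at this
    exact absurd this (norm_nonneg _).not_gt
  refine mul_left_cancel₀ h2 (h1.trans ?_)
  change (p : ℍ) * (((k * D : ℝ) : ℍ) * u) + (k : ℍ) * y * u =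
    ((p : ℍ) * star ((k : ℍ) * y) + ((k * D : ℝ) : ℍ)) * q
  have h3 : (p : ℍ) * star y * r + (D : ℝ) * r = p * D + y := by
    rw [hsy, mul_sub, ← mul_assoc, hpp, hy, ← hD]
    generalize (p : ℍ) = P
    ext <;> simp [-Quaternion.coe_mul, -Quaternion.coe_sub, -Quaternion.coe_pow, sub_mul] <;> ring
  rw [hu]
  calc _ = (k : ℍ) * (p * D + y) * u := by
        rw [Quaternion.coe_mul, ← mul_assoc, ← mul_assoc, ← Quaternion.coe_commutes k (p : ℍ)]
        noncomm_ring
    _ = _ := by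
        have h4 : (p : ℍ) * star ((k : ℍ) * y) = k * (p * star y) := by
          rw [star_mul, Quaternion.star_coe, ← mul_assoc, ← Quaternion.coe_commutes]
        rw [← h3, h4, Quaternion.coe_mul]
        noncomm_ring

end Transitivity

/-! ### Submersions from smooth sections -/

section Section

variable {E E' H H' X M : Type*} [NormedAddCommGroup E] [NormedSpace ℝ E]
  [NormedAddCommGroup E'] [NormedSpace ℝ E'] [TopologicalSpace H] [TopologicalSpace H']
  [TopologicalSpace X] [TopologicalSpace M] [ChartedSpace H X] [ChartedSpace H' M]

/-- The differential of a smooth map with a smooth section through `x` is surjective at `x`. -/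
theorem surjective_mfderiv_of_section {I : ModelWithCorners ℝ E H} {I' : ModelWithCorners ℝ E' H'}
    {f : X → M} {s : M → X} (hf : ContMDiff I I' ∞ f) (hs : ContMDiff I' I ∞ s)
    (h : ∀ m, f (s m) = m) {x : X} (hx : s (f x) = x) :
    Function.Surjective (mfderiv I I' f x) := by
  have hd := mfderiv_comp (I := I') (I' := I) (I'' := I') (f x) (f := s) (g := f)
    ((hf _).mdifferentiableAt (by simp)) ((hs _).mdifferentiableAt (by simp))
  have hid : f ∘ s = id := funext h
  rw [hid, mfderiv_id, hx] at hd
  intro y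
  exact ⟨mfderiv I' I s (f x) y, (congrArg (fun T => T y) hd).symm⟩

end Section

/-! ### Existence of the quotient manifold structure and its coordinates -/

namespace MB

/-- The bijection `ℍ × Sp(1) ≃ 𝓜(𝔹)`. -/
def coordEquiv : Coord ≃ MB := Equiv.ofBijective ofCoord ⟨ofCoord_injective, ofCoord_surjective⟩

/-- A linear isomorphism `ℍ × ℝ³ ≃ ℝ⁷`. -/
def modelEquiv : (ℍ × EuclideanSpace ℝ (Fin 3)) ≃L[ℝ] EuclideanSpace ℝ (Fin 7) :=
  ContinuousLinearEquiv.ofFinrankEq (by simp [Quaternion.finrank_eq_four])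

/-- The isomorphism `ℍ × ℝ³ ≃ ℝ⁷`, as a homeomorphism of the model spaces. -/
def modelHomeo : ModelProd ℍ (EuclideanSpace ℝ (Fin 3)) ≃ₜ EuclideanSpace ℝ (Fin 7) :=
  modelEquiv.toHomeomorph

theorem contMDiff_modelHomeo : ContMDiff coordModel (𝓡 7) ∞ modelHomeo := by
  refine contMDiff_iff.2 ⟨modelHomeo.continuous, fun x y => ?_⟩
  exact modelEquiv.contDiff.contDiffOn

theorem contMDiff_modelHomeo_symm : ContMDiff (𝓡 7) coordModel ∞ modelHomeo.symm := by
  refine contMDiff_iff.2 ⟨modelHomeo.symm.continuous, fun x y => ?_⟩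
  exact modelEquiv.symm.contDiff.contDiffOn

theorem exists_isQuotientManifold : ∃ (_ : TopologicalSpace MB)
    (_ : ChartedSpace (EuclideanSpace ℝ (Fin 7)) MB), IsQuotientManifold := by
  let _ : TopologicalSpace MB := .coinduced coordEquiv inferInstance
  let e : Coord ≃ₜ MB :=
    { coordEquiv with
      continuous_toFun := continuous_coinduced_rng
      continuous_invFun := continuous_coinduced_dom.2 (by
        have : ⇑coordEquiv.symm ∘ ⇑coordEquiv = id := coordEquiv.symm_comp_self
        exact this ▸ continuous_id) }
  let _ := transportChartedSpace e modelHomeo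
  have hM : IsManifold (𝓡 7) ∞ MB :=
    isManifold_transport e modelHomeo contMDiff_modelHomeo contMDiff_modelHomeo_symm
  obtain ⟨he, he'⟩ :=
    contMDiff_transport e modelHomeo contMDiff_modelHomeo contMDiff_modelHomeo_symm
  have hproj : proj = e ∘ quo := funext fun A => (ofCoord_quo A).symm
  have hsm : ContMDiff Sp11.model (𝓡 7) ∞ proj := hproj ▸ he.comp contMDiff_quo
  have hinv : ∀ v F, proj (sec v (e.symm F)) = F := fun v F =>
    (proj_sec v _).trans (e.apply_symm_apply F)
  -- A continuous map with a continuous global section is a quotient map; the section with `v = 1`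
  -- serves here.
  refine ⟨_, _, hM, e.symm.isEmbedding.t2Space, e.symm.isEmbedding.secondCountableTopology,
    .of_inverse ((contMDiff_sec 1).continuous.comp e.symm.continuous) hsm.continuous (hinv 1), hsm,
    fun A => ?_⟩
  -- For the differential at `A`, the section has to pass through `A`, which fixes `v`.
  set v := (Sp11.homeo A⁻¹).2.2 with hv
  have hs : ContMDiff (𝓡 7) Sp11.model ∞ (fun F => sec v (e.symm F)) := (contMDiff_sec v).comp he'
  have hA : sec v (e.symm (proj A)) = A := by
    have : e.symm (proj A) = quo A := by rw [hproj]; exact e.symm_apply_apply _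
    rw [this, hv, sec_quo]
  exact surjective_mfderiv_of_section hsm hs (hinv v) hA

section QuotientManifold

variable [TopologicalSpace MB] [ChartedSpace (EuclideanSpace ℝ (Fin 7)) MB]

theorem IsQuotientManifold.contMDiff_ofCoord (h : IsQuotientManifold) :
    ContMDiff coordModel (𝓡 7) ∞ ofCoord :=
  (h.contMDiff_proj.comp (contMDiff_sec 1)).congr fun x => (proj_sec 1 x).symm

/-- The coordinates of `𝓜(𝔹)`, as a homeomorphism. -/
def IsQuotientManifold.coordHomeo (h : IsQuotientManifold) : Coord ≃ₜ MB :=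
  { coordEquiv with
    continuous_toFun := h.contMDiff_ofCoord.continuous
    continuous_invFun := by
      -- Composed with the quotient map `proj`, the inverse becomes `quo`.
      refine h.isQuotientMap.continuous_iff.2 (contMDiff_quo.continuous.congr fun A => ?_)
      exact (coordEquiv.symm_apply_eq.2 (ofCoord_quo A).symm).symm }

/-- By the chain rule for `proj = ofCoord ∘ quo`, surjectivity of the differential of `proj` passes
to `ofCoord`. Both sides have dimension `4 + 3 = 7`, so the inverse function theorem applies. Every
admissible structure thus has the same smooth coordinates. -/
theorem IsQuotientManifold.contMDiff_coordHomeo_symm (h : IsQuotientManifold) :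
    ContMDiff (𝓡 7) coordModel ∞ h.coordHomeo.symm := by
  refine contMDiff_symm_of_surjective_mfderiv (by simp [Quaternion.finrank_eq_four])
    h.coordHomeo h.contMDiff_ofCoord fun x => ?_
  obtain ⟨A, rfl⟩ : ∃ A, quo A = x := ⟨sec 1 x, quo_sec 1 x⟩
  have hp : proj = ofCoord ∘ quo := funext fun A => (ofCoord_quo A).symm
  have h1 := mfderiv_comp (I := Sp11.model) (I' := coordModel) (I'' := 𝓡 7) A
    (f := quo) (g := ofCoord)
    ((h.contMDiff_ofCoord _).mdifferentiableAt (by simp))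
    ((contMDiff_quo _).mdifferentiableAt (by simp))
  have hs := h.surjective_mfderiv A
  rw [hp, h1] at hs
  exact Function.Surjective.of_comp hs

/-- The section `sec 1` lifts an element of `𝓜(𝔹)` smoothly to a matrix, where `contMDiff_mobius`
applies. -/
theorem IsQuotientManifold.contMDiff_eval (h : IsQuotientManifold) :
    ContMDiff ((𝓡 7).prod 𝓘(ℝ, ℍ)) 𝓘(ℝ, ℍ) ∞ (fun x : MB × Ball => x.1 x.2) := by
  have h1 : ContMDiff ((𝓡 7).prod 𝓘(ℝ, ℍ)) Sp11.model ∞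
      (fun x : MB × Ball => (sec 1 (h.coordHomeo.symm x.1))⁻¹) :=
    Sp11.contMDiff_inv.comp ((contMDiff_sec 1).comp
      (h.contMDiff_coordHomeo_symm.comp contMDiff_fst))
  refine (contMDiff_mobius.comp (h1.prodMk contMDiff_snd)).congr fun x => ?_
  have h2 : proj (sec 1 (h.coordHomeo.symm x.1)) = x.1 :=
    (proj_sec 1 _).trans (h.coordHomeo.apply_symm_apply x.1)
  exact congrArg (fun F : MB => F x.2) h2.symm

end QuotientManifold

end MB

/-! ### The isotropy at the origin -/

namespace MB

theorem ofCoord_zero_left (u : Sp1) : (ofCoord (0, u)).1 = R u := by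
  funext q
  refine Subtype.ext ?_
  obtain ⟨e1, e2, e3, e4⟩ := coord_entries ((0, u) : Coord)
  refine (mobius_apply_of_eq (Sp11.homeo.symm (0, u, 1)) q (G := 1) ?_).trans ?_
  · rw [e2, e4]; simp
  · rw [e1, e3]; simp [R]

theorem ofCoord_mem_isotropy_iff (x : Coord) : ofCoord x ∈ isotropy ↔ x.1 = 0 := by
  have hs : (√(1 + ‖x.1‖ ^ 2))⁻¹ ≠ 0 := inv_ne_zero (Real.sqrt_pos.2 (by positivity)).ne'
  have h : ofCoord x ∈ isotropy ↔ (ofCoord x 0 : ℍ) = 0 := Subtype.ext_iff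
  rw [h, ofCoord_zero, smul_eq_zero_iff_right hs]

theorem setOf_isotropy_eq_range_R :
    {f : Ball → Ball | f ∈ mobiusSet ∧ f 0 = 0} = Set.range R := by
  ext f
  constructor
  · rintro ⟨hf, h0⟩
    obtain ⟨⟨b, u⟩, hx⟩ := ofCoord_surjective ⟨f, hf⟩
    have h1 : ofCoord (b, u) ∈ isotropy := hx ▸ h0
    obtain rfl : b = 0 := (ofCoord_mem_isotropy_iff _).1 h1
    exact ⟨u, by rw [← ofCoord_zero_left, hx]⟩
  · rintro ⟨u, rfl⟩
    rw [← ofCoord_zero_left]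
    exact ⟨(ofCoord (0, u)).2, (ofCoord_mem_isotropy_iff (0, u)).2 rfl⟩

/-- Right multiplication reverses the order of products; the inverse restores it. Hence `u ↦
R_{u⁻¹}`, and not `u ↦ R_u`, is the homomorphism. -/
theorem R_mul_inv (u v : Sp1) (q : Ball) : R (u * v)⁻¹ q = R u⁻¹ (R v⁻¹ q) := by
  refine Subtype.ext ?_
  simp [R, mul_assoc]

section QuotientManifold

variable [TopologicalSpace MB] [ChartedSpace (EuclideanSpace ℝ (Fin 7)) MB]

/-- The homeomorphism `u ↦ R_u` from `Sp(1)` to the isotropy at `0`. -/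
def IsQuotientManifold.isotropyHomeo (h : IsQuotientManifold) : Sp1 ≃ₜ isotropy where
  toFun u := ⟨ofCoord (0, u), (ofCoord_mem_isotropy_iff _).2 rfl⟩
  invFun F := (h.coordHomeo.symm F.1).2
  left_inv u := congrArg Prod.snd (h.coordHomeo.symm_apply_apply (0, u))
  right_inv F := by
    obtain ⟨F, hF⟩ := F
    obtain ⟨⟨b, u⟩, rfl⟩ := ofCoord_surjective F
    obtain rfl : b = 0 := (ofCoord_mem_isotropy_iff _).1 hF
    refine Subtype.ext ?_
    have : h.coordHomeo.symm (ofCoord (0, u)) = (0, u) := h.coordHomeo.symm_apply_apply (0, u)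
    simp only [this]
  continuous_toFun := by
    refine Continuous.subtype_mk (h.contMDiff_ofCoord.continuous.comp ?_) _
    exact continuous_const.prodMk continuous_id
  continuous_invFun :=
    continuous_snd.comp (h.coordHomeo.symm.continuous.comp continuous_subtype_val)

theorem IsQuotientManifold.isotropyHomeo_apply (h : IsQuotientManifold) (u : Sp1) (q : Ball) :
    (h.isotropyHomeo u).1 q = R u q :=
  congrFun (ofCoord_zero_left u) q

theorem IsQuotientManifold.isCompact_isotropy (h : IsQuotientManifold) : IsCompact isotropy := by
  have : CompactSpace isotropy := h.isotropyHomeo.compactSpace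
  exact isCompact_iff_compactSpace.2 this

/-- The manifold structure of the isotropy at `0`. -/
@[reducible]
def IsQuotientManifold.isotropyChartedSpace (h : IsQuotientManifold) :
    ChartedSpace (EuclideanSpace ℝ (Fin 3)) isotropy :=
  transportChartedSpace h.isotropyHomeo (Homeomorph.refl _)

theorem IsQuotientManifold.isManifold_isotropy (h : IsQuotientManifold) :
    letI := h.isotropyChartedSpace
    IsManifold (𝓡 3) ∞ isotropy :=
  isManifold_transport h.isotropyHomeo (Homeomorph.refl _) contMDiff_id contMDiff_id

theorem IsQuotientManifold.contMDiff_isotropyHomeo (h : IsQuotientManifold) :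
    letI := h.isotropyChartedSpace
    ContMDiff (𝓡 3) (𝓡 3) ∞ h.isotropyHomeo ∧ ContMDiff (𝓡 3) (𝓡 3) ∞ h.isotropyHomeo.symm :=
  contMDiff_transport h.isotropyHomeo (Homeomorph.refl _) contMDiff_id contMDiff_id

/-- The chart of `𝓜(𝔹)` given by its coordinates and a chart of `ℍ × Sp(1)`. -/
def IsQuotientManifold.coordChart (h : IsQuotientManifold) (x : Coord) :
    OpenPartialHomeomorph MB (EuclideanSpace ℝ (Fin 7)) :=
  h.coordHomeo.symm.toOpenPartialHomeomorph ≫ₕ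
    chartAt (ModelProd ℍ (EuclideanSpace ℝ (Fin 3))) x ≫ₕ modelHomeo.toOpenPartialHomeomorph

theorem IsQuotientManifold.coordChart_mem_maximalAtlas (h : IsQuotientManifold) (x : Coord) :
    h.coordChart x ∈ IsManifold.maximalAtlas (𝓡 7) ∞ MB := by
  have := h.isManifold
  have h1 := contMDiffOn_chart (I := coordModel) (n := ∞) (x := x)
  have h2 := contMDiffOn_chart_symm (I := coordModel) (n := ∞) (x := x)
  refine OpenPartialHomeomorph.mem_maximalAtlas_of_contMDiffOn _ ?_ ?_
  · refine ((contMDiff_modelHomeo.comp_contMDiffOn h1).comp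
      (h.contMDiff_coordHomeo_symm.contMDiffOn (s := (h.coordChart x).source)) fun F hF => ?_)
    simpa [coordChart] using hF
  · refine h.contMDiff_ofCoord.comp_contMDiffOn (h2.comp
      (contMDiff_modelHomeo_symm.contMDiffOn (s := (h.coordChart x).target)) fun y hy => ?_)
    simpa [coordChart] using hy

/-- In the coordinates `(b, w)` the isotropy is the slice `{0} × Sp(1)`, so product charts are slice
charts, with complement `ℍ`. -/
theorem IsQuotientManifold.isSmoothEmbedding_isotropy (h : IsQuotientManifold) :
    letI := h.isotropyChartedSpace
    Manifold.IsSmoothEmbedding (𝓡 3) (𝓡 7) ∞ (Subtype.val : isotropy → MB) := by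
  let _ := h.isotropyChartedSpace
  have hM := h.isManifold_isotropy
  refine ⟨?_, Topology.IsEmbedding.subtypeVal⟩
  refine Manifold.IsImmersionOfComplement.isImmersion (F := ℍ) fun F => ?_
  obtain ⟨u, rfl⟩ := h.isotropyHomeo.surjective F
  have hc : chartAt (EuclideanSpace ℝ (Fin 3)) (h.isotropyHomeo u) =
      h.isotropyHomeo.symm.toOpenPartialHomeomorph ≫ₕ chartAt (EuclideanSpace ℝ (Fin 3)) u ≫ₕ
        (Homeomorph.refl _).toOpenPartialHomeomorph := by
    change h.isotropyHomeo.symm.toOpenPartialHomeomorph ≫ₕ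
      chartAt _ (h.isotropyHomeo.symm (h.isotropyHomeo u)) ≫ₕ _ = _
    rw [h.isotropyHomeo.symm_apply_apply]
  have hx : h.coordHomeo.symm (h.isotropyHomeo u).1 = (0, u) :=
    h.coordHomeo.symm_apply_apply (0, u)
  -- The normal form of an immersion is `y ↦ (y, 0)`, while the coordinates have the factor `ℍ`
  -- first; hence the swap before `modelEquiv`.
  refine Manifold.IsImmersionAtOfComplement.mk_of_continuousAt continuous_subtype_val.continuousAt
    ((ContinuousLinearEquiv.prodComm ℝ _ _).trans modelEquiv)
    (chartAt _ (h.isotropyHomeo u)) (h.coordChart (0, u)) (mem_chart_source _ _) ?_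
    (IsManifold.chart_mem_maximalAtlas _) (h.coordChart_mem_maximalAtlas _) ?_
  · simp [coordChart, hx]
  · intro y hy
    rw [hc] at hy ⊢
    have hy' : y ∈ (chartAt (EuclideanSpace ℝ (Fin 3)) u).target := by simpa using hy
    have h1 : h.coordHomeo.symm (ofCoord (0, (chartAt (EuclideanSpace ℝ (Fin 3)) u).symm y)) =
        (0, (chartAt (EuclideanSpace ℝ (Fin 3)) u).symm y) :=
      h.coordHomeo.symm_apply_apply _
    change modelEquiv (chartAt (ModelProd ℍ (EuclideanSpace ℝ (Fin 3))) ((0, u) : Coord)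
      (h.coordHomeo.symm (ofCoord (0, (chartAt (EuclideanSpace ℝ (Fin 3)) u).symm y)))) =
      modelEquiv (0, y)
    rw [h1]
    refine congrArg modelEquiv ?_
    rw [prodChartedSpace_chartAt]
    exact Prod.ext rfl ((chartAt (EuclideanSpace ℝ (Fin 3)) u).right_inv hy')

/-- The bijection `u ↦ R_{u⁻¹}` from `Sp(1)` to the isotropy at `0`. -/
def IsQuotientManifold.isotropyEquiv (h : IsQuotientManifold) : Sp1 ≃ isotropy :=
  (Equiv.inv Sp1).trans h.isotropyHomeo.toEquiv

theorem IsQuotientManifold.isotropyEquiv_apply (h : IsQuotientManifold) (u : Sp1) (q : Ball) :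
    (h.isotropyEquiv u).1 q = R u⁻¹ q :=
  h.isotropyHomeo_apply u⁻¹ q

theorem IsQuotientManifold.exists_lieGroup_isotropy (h : IsQuotientManifold) :
    ∃ (_ : ChartedSpace (EuclideanSpace ℝ (Fin 3)) isotropy) (_ : Group isotropy),
      IsManifold (𝓡 3) ∞ isotropy ∧
      Manifold.IsSmoothEmbedding (𝓡 3) (𝓡 7) ∞ (Subtype.val : isotropy → MB) ∧
      (∀ (F G : isotropy) (q : Ball), (F * G).1 q = F.1 (G.1 q)) ∧
      LieGroup (𝓡 3) ∞ isotropy ∧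
      ∃ ρ : Sp1 ≃* isotropy, (∀ (u : Sp1) (q : Ball), (ρ u).1 q = R u⁻¹ q) ∧
        ContMDiff (𝓡 3) (𝓡 3) ∞ ρ ∧ ContMDiff (𝓡 3) (𝓡 3) ∞ ρ.symm := by
  let _ := h.isotropyChartedSpace
  have hM := h.isManifold_isotropy
  -- The group law is carried over from `Sp(1)` along `u ↦ R_{u⁻¹}`, so this map is an isomorphism
  -- by construction. That the law is composition is then `R_mul_inv`.
  let _ : Group isotropy := h.isotropyEquiv.symm.group
  let ρ : Sp1 ≃* isotropy := h.isotropyEquiv.symm.mulEquiv.symm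
  have hρ : ∀ (u : Sp1) (q : Ball), (ρ u).1 q = R u⁻¹ q := h.isotropyEquiv_apply
  have hs : ContMDiff (𝓡 3) (𝓡 3) ∞ ρ :=
    (h.contMDiff_isotropyHomeo.1.comp (contMDiff_inv (𝓡 3) ∞)).congr fun u => rfl
  have hs' : ContMDiff (𝓡 3) (𝓡 3) ∞ ρ.symm :=
    h.contMDiff_isotropyHomeo.2.inv.congr fun F => rfl
  refine ⟨_, _, hM, h.isSmoothEmbedding_isotropy, fun F G q => ?_, ?_, ρ, hρ, hs, hs'⟩
  · obtain ⟨u, rfl⟩ := ρ.surjective F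
    obtain ⟨v, rfl⟩ := ρ.surjective G
    rw [← map_mul, hρ, hρ, hρ, R_mul_inv]
  · have hmul : ContMDiff ((𝓡 3).prod (𝓡 3)) (𝓡 3) ∞ fun p : isotropy × isotropy => p.1 * p.2 :=
      (hs.comp ((hs'.comp contMDiff_fst).mul (hs'.comp contMDiff_snd))).congr fun p => by
        simp
    have hinv : ContMDiff (𝓡 3) (𝓡 3) ∞ fun F : isotropy => F⁻¹ :=
      (hs.comp hs'.inv).congr fun F => by simp
    exact { hM with contMDiff_mul := hmul, contMDiff_inv := hinv }

end QuotientManifold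

end MB

end RegMobius

end

theorem mainTheorem3 :
    -- `𝓜(𝔹)` has a manifold structure coming from `Sp(1,1)/Sp(1)I₂`
    (∃ (_ : TopologicalSpace RegMobius.MB)
      (_ : ChartedSpace (EuclideanSpace ℝ (Fin 7)) RegMobius.MB),
      RegMobius.MB.IsQuotientManifold) ∧
    ∀ [TopologicalSpace RegMobius.MB] [ChartedSpace (EuclideanSpace ℝ (Fin 7)) RegMobius.MB],
      RegMobius.MB.IsQuotientManifold →
      -- the evaluation map is smooth
      ContMDiff ((𝓡 7).prod 𝓘(ℝ, ℍ)) 𝓘(ℝ, ℍ) ∞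
        (fun x : RegMobius.MB × RegMobius.Ball => x.1 x.2) ∧
      -- transitivity
      (∀ p q : RegMobius.Ball, ∃ F : RegMobius.MB, F p = q) ∧
      -- the isotropy at `0`
      {f : RegMobius.Ball → RegMobius.Ball | f ∈ RegMobius.mobiusSet ∧ f 0 = 0} =
        Set.range RegMobius.R ∧
      -- the isotropy at `0` is a compact embedded submanifold, and a Lie group under composition,
      -- isomorphic to `Sp(1)` by `u ↦ R_{u⁻¹}`
      IsCompact RegMobius.MB.isotropy ∧
      ∃ (_ : ChartedSpace (EuclideanSpace ℝ (Fin 3)) RegMobius.MB.isotropy)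
        (_ : Group RegMobius.MB.isotropy),
        IsManifold (𝓡 3) ∞ RegMobius.MB.isotropy ∧
        Manifold.IsSmoothEmbedding (𝓡 3) (𝓡 7) ∞
          (Subtype.val : RegMobius.MB.isotropy → RegMobius.MB) ∧
        (∀ (F G : RegMobius.MB.isotropy) (q : RegMobius.Ball), (F * G).1 q = F.1 (G.1 q)) ∧
        LieGroup (𝓡 3) ∞ RegMobius.MB.isotropy ∧
        ∃ ρ : RegMobius.Sp1 ≃* RegMobius.MB.isotropy,
          (∀ (u : RegMobius.Sp1) (q : RegMobius.Ball), (ρ u).1 q = RegMobius.R u⁻¹ q) ∧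
          ContMDiff (𝓡 3) (𝓡 3) ∞ ρ ∧ ContMDiff (𝓡 3) (𝓡 3) ∞ ρ.symm := by
  refine ⟨RegMobius.MB.exists_isQuotientManifold, fun h => ⟨h.contMDiff_eval, fun p q => ?_,
    RegMobius.MB.setOf_isotropy_eq_range_R, h.isCompact_isotropy, h.exists_lieGroup_isotropy⟩⟩
  obtain ⟨A, hA⟩ := RegMobius.exists_mobius_apply_eq p q
  exact ⟨⟨_, A, rfl⟩, hA⟩
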